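/- Setting. Let $V=[n]$ and let $V=\bigsqcup_{i=1}^k V_i$ be an unknown clustering (the "true clustering", with any number $k$ of nonempty clusters). A symmetric faulty oracle with error probability $p$, $0<p<\tfrac12$, answers each query $\{u,v\}$, $u\neq v$, "do $u$ and $v$ belong to the same cluster?" wrongly with probability $p$, independently over the $\binom n2$ pairs; repeating a query gives the same answer. Put $\omega(u,v)=+1$ if the answer is "yes", $\omega(u,v)=-1$ if it is "no", and $\omega(u,u)=0$. A clustering is a maximum likelihood (ML) clustering for given $\binom n2$ answers if no clustering of $V$ gives these answers a larger probability. Let $\log$ be the natural logarithm, $c=\frac{16}{(1-2p)^2}$, $c'=6c=\frac{96}{(1-2p)^2}$ and $l=\lceil c\log n\rceil$. Algorithm. The vertices are selected one by one in some fixed order. The algorithm keeps a list of disjoint active clusters (initially empty) and a set $V'$ of vertices, all pairs of which have been queried; $G'$ is the complete graph on $V'$ with weights $\omega$. 1. Put the first $l$ vertices (all of them if $n<l$) into $V'$, query all pairs in $V'$ and perform Extract. 2. Extract: let $S\subseteq V'$ be a heaviest weight subgraph of $G'$, i.e. a subset maximizing $\sum_{i,j\in S,\,i\neq j}\omega(i,j)$.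 If $|S|\ge c\log n$: remove $S$ from $V'$; then, for each remaining $z\in V'$ in turn, if $\sum_{u\in S}\omega(z,u)>0$ move $z$ from $V'$ to $S$; append $S$ to the list of active clusters and repeat Extract. Otherwise stop extracting. 3. While there are unselected vertices, select the next one, $v$. Go through the active clusters in order; for an active cluster $C$ choose $l$ distinct vertices of $C$ and query $v$ with them. Include $v$ in the first $C$ for which a strict majority of these answers is "yes". If there is no such $C$ (in particular if no cluster is active), add $v$ to $V'$, query $v$ with all other vertices of $V'$ and perform Extract. 4. When all vertices have been selected, return the active clusters together with the clusters of a partition of the final $V'$ into sets $S_1,S_2,\dots$ that maximizes $\sum_\ell\sum_{i,j\in S_\ell,\,i\ne j}\omega(i,j)$. The algorithm is deterministic: the order, the $l$ vertices (chosen as a function of $v$ and $C$), and the choice among several heaviest subgraphs or several maximizing partitions (made as a function of $V'$ and the weights in $G'$) are given by arbitrary fixed rules. Theorem. For every $p\in(0,\tfrac12)$ there is a sequence $\varepsilon_n\to0$, depending only on $p$, such that for all $n$, all true clusterings of $[n]$ and all such rules, each of the following holds with probability at least $1-\varepsilon_n$ over the oracle's answers: (i) if the true clustering is the (unique) ML clustering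 for all $\binom n2$ answers, then the algorithm returns exactly the true clusters; (ii) if the true clustering is an ML clustering for all $\binom n2$ answers, possibly tied with others, then the algorithm returns an ML clustering for all $\binom n2$ answers; (iii) the algorithm returns every true cluster of size at least $c'\log n$. -/

import Mathlib

open MeasureTheory Filter Topology

namespace FaultyOracle

noncomputable section

/-- The unordered pairs of distinct elements of `[n]`; there are `n` choose `2` of them. -/
abbrev Pair (n : ℕ) : Type := {e : Sym2 (Fin n) // ¬ e.IsDiag}

/-- A complete set of query answers: one answer (`true` is "yes, same cluster", `false` is "no")
for every pair. A repeated query gets the same answer. -/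
abbrev Answers (n : ℕ) : Type := Pair n → Bool

/-- A clustering of the `n` points: a partition into (any number of) nonempty clusters. -/
abbrev Clustering (n : ℕ) : Type := Finpartition (Finset.univ : Finset (Fin n))

open Classical in
/-- The correct answer to the query `e` if the clustering is `T`. -/
def truth {n : ℕ} (T : Clustering n) (e : Pair n) : Bool :=
  decide (∃ C ∈ T.parts, ∀ x ∈ e.1, x ∈ C)

/-- The law of all `n` choose `2` answers of the symmetric faulty oracle with error probability
`p` when the true clustering is `T`: independently for each pair, the answer is wrong with
probability `p` and correct with probability `1 - p`. -/
def oracleLaw {n : ℕ} (p : unitInterval) (T : Clustering n) : Measure (Answers n) :=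
  Measure.pi fun e => ProbabilityTheory.bernoulliMeasure (!(truth T e)) (truth T e) p

/-- `T` is a maximum likelihood clustering for the answers `a`: no clustering gives the observed
answers a larger probability. -/
def IsML {n : ℕ} (p : unitInterval) (a : Answers n) (T : Clustering n) : Prop :=
  ∀ Q : Clustering n, oracleLaw p Q {a} ≤ oracleLaw p T {a}

/-- `T` is the maximum likelihood clustering for the answers `a`, i.e. the only one. -/
def IsUniqueML {n : ℕ} (p : unitInterval) (a : Answers n) (T : Clustering n) : Prop :=
  IsML p a T ∧ ∀ Q : Clustering n, IsML p a Q → Q = T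

/-- The weight `ω(u,v)`: `+1` if the answer is "yes", `-1` if it is "no", and `ω(u,u) = 0`. -/
def weight {n : ℕ} (a : Answers n) (u v : Fin n) : ℤ :=
  if h : u = v then 0
  else if a ⟨s(u, v), fun hd => h (Sym2.mk_isDiag_iff.mp hd)⟩ = true then 1 else -1

/-- The weighted graph `G'` on the vertex set `A`: the weights of the pairs inside `A`, and `0`
for every other pair. A rule that is given `restrict w A` sees no query answer outside `A`. -/
def restrict {n : ℕ} (w : Fin n → Fin n → ℤ) (A : Finset (Fin n)) (u v : Fin n) : ℤ :=
  if u ∈ A ∧ v ∈ A then w u v else 0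

/-- Total weight inside `S`, summed over the ordered pairs `i ≠ j` in `S`. -/
def inner {n : ℕ} (w : Fin n → Fin n → ℤ) (S : Finset (Fin n)) : ℤ :=
  ∑ e ∈ S.offDiag, w e.1 e.2

/-- Total intra-cluster weight of a partition of the vertex set `A`. -/
def intraWeight {n : ℕ} (w : Fin n → Fin n → ℤ) {A : Finset (Fin n)} (Q : Finpartition A) : ℤ :=
  ∑ S ∈ Q.parts, inner w S

/-- The choices that the description of the algorithm leaves open. The algorithm is deterministic,
and the theorem is about every way of making these choices. -/
structure Choices (n : ℕ) where
  /-- the order in which the vertices are selected -/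
  order : Equiv.Perm (Fin n)
  /-- a heaviest weight subgraph of the graph with vertex set `A` and weights `w` -/
  heaviest : (Fin n → Fin n → ℤ) → Finset (Fin n) → Finset (Fin n)
  heaviest_subset : ∀ w A, heaviest w A ⊆ A
  heaviest_max : ∀ w A, ∀ B ⊆ A, inner w B ≤ inner w (heaviest w A)
  /-- `l` distinct vertices of the cluster `C`, with which the vertex `v` is to be queried -/
  pick : ℕ → Fin n → Finset (Fin n) → Finset (Fin n)
  pick_subset : ∀ l v C, pick l v C ⊆ C
  pick_card : ∀ l v C, l ≤ C.card → (pick l v C).card = l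
  /-- a clustering of `A` of maximum total intra-cluster weight -/
  mlClustering : (Fin n → Fin n → ℤ) → (A : Finset (Fin n)) → Finpartition A
  mlClustering_max : ∀ w A, ∀ Q : Finpartition A, intraWeight w Q ≤ intraWeight w (mlClustering w A)

/-- `⌈c log n⌉` with `c = 16 / (1 - 2p)²`; a finite set has size at least `c log n` if and only if
it has size at least this number. -/
def size (p : ℝ) (n : ℕ) : ℕ := ⌈16 / (1 - 2 * p) ^ 2 * Real.log n⌉₊

/-- All vertices, in the order in which they are selected. -/
def Choices.vertices {n : ℕ} (R : Choices n) : List (Fin n) := (List.finRange n).map R.order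

/-- Growing a newly extracted set: run through the vertices `z` of `A`, and include `z` in the current set `S`
whenever `∑ u ∈ S, ω(z,u) > 0`. -/
def absorb {n : ℕ} (R : Choices n) (w : Fin n → Fin n → ℤ) (S A : Finset (Fin n)) :
    Finset (Fin n) :=
  (R.vertices.filter (· ∈ A)).foldl
    (fun S z => if 0 < ∑ u ∈ S, w z u then insert z S else S) S

/-- Extraction from `G'`, whose vertex set is `V'`, with the list `active` of the clusters found so
far: as long as the heaviest weight subgraph `S` of `G'` has size at least `l`, remove it from `G'`,
let it absorb further vertices of `G'`, and add it to the list. (The test `S.Nonempty` is automatic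
for `0 < l`, that is for `2 ≤ n`.) -/
def extract {n : ℕ} (R : Choices n) (w : Fin n → Fin n → ℤ) (l : ℕ)
    (active : List (Finset (Fin n))) (V' : Finset (Fin n)) :
    List (Finset (Fin n)) × Finset (Fin n) :=
  if h : l ≤ (R.heaviest (restrict w V') V').card ∧ (R.heaviest (restrict w V') V').Nonempty then
    let S := R.heaviest (restrict w V') V'
    let S' := absorb R w S (V' \ S)
    extract R w l (active ++ [S']) ((V' \ S) \ S')
  else (active, V')
termination_by V'.card
decreasing_by
  refine (Finset.card_le_card Finset.sdiff_subset).trans_lt (Finset.card_lt_card ?_)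
  exact Finset.sdiff_ssubset (R.heaviest_subset _ _) h.2

/-- Growing an active cluster: include `v` in the first cluster `C` of the list for which the majority of the
answers to the queries of `v` with `l` distinct vertices of `C` is "yes"; `none` if there is no such
cluster. -/
def join {n : ℕ} (R : Choices n) (w : Fin n → Fin n → ℤ) (l : ℕ) (v : Fin n) :
    List (Finset (Fin n)) → Option (List (Finset (Fin n)))
  | [] => none
  | C :: Cs =>
    if 0 < ∑ u ∈ R.pick l v C, w v u then some (insert v C :: Cs)
    else (join R w l v Cs).map (C :: ·)

/-- The treatment of a newly selected vertex `v`: include it in an active cluster if possible,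
otherwise (in particular if there is no active cluster yet) add it to `V'` and extract from the new `G'`. -/
def process {n : ℕ} (R : Choices n) (w : Fin n → Fin n → ℤ) (l : ℕ)
    (s : List (Finset (Fin n)) × Finset (Fin n)) (v : Fin n) :
    List (Finset (Fin n)) × Finset (Fin n) :=
  match join R w l v s.1 with
  | some active => (active, s.2)
  | none => extract R w l s.1 (insert v s.2)

/-- The exploration: start with the first `l` vertices (all of them if `n < l`), then process the
other vertices one by one. The result is the final list of active clusters and the final `V'`. -/
def explore {n : ℕ} (R : Choices n) (w : Fin n → Fin n → ℤ) (l : ℕ) :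
    List (Finset (Fin n)) × Finset (Fin n) :=
  (R.vertices.drop l).foldl (process R w l) (extract R w l [] (R.vertices.take l).toFinset)

/-- The clusters returned by the algorithm on the answers `a`: the active clusters together with
the clusters of a maximum likelihood clustering of the final `G'`. -/
def output {n : ℕ} (p : ℝ) (R : Choices n) (a : Answers n) : Finset (Finset (Fin n)) :=
  let s := explore R (weight a) (size p n)
  s.1.toFinset ∪ (R.mlClustering (restrict (weight a) s.2) s.2).parts

end

end FaultyOracle

/-! The exploration is adaptive, but on a good event it only compares sets that are fixed in
advance. After the vertices of a prefix `P` of the order have been treated, every active cluster is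
a whole piece `K ∩ P` of a true cluster, and the remaining pieces lie in `V'` and have fewer than `2
* l` vertices (`Invariant`). So the bad events can be indexed by prefixes, true clusters and vertex
sets instead of random states, and a union bound over all the answers works without conditioning.

Two events carry the invariant. `GoodVotes` sends each new vertex to the right active cluster, or to
none. `HeavyPieces` says that a heaviest subgraph with at least `l` vertices is the whole piece of
the cluster it meets most, and that it cannot have fewer than `l` vertices while a remaining piece
has `2 * l`. Hence extraction removes whole pieces and stops only when the others are below `2 * l`;
absorption does nothing, by maximality.

The main work is the probability of `HeavyPieces`, a union over exponentially many sets `S`. A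
Chernoff bound for the difference of the two weights has exponent proportional to `gap`. This pays
`log n` for every other cluster that `S` meets, `(log n) / 24` for every vertex in which `S` differs
from the piece, and `3 * log n` besides (`gap_ge_of_large`, `gap_ge_of_small`). A set is determined
by its traces on the clusters, so the sum over `S` factors over clusters, and since the pieces
involved have at most `2 * l` vertices each factor is controlled by `(1 + n ^ (-1/24)) ^ (2 * l)`,
which stays bounded (`sum_critical_prob_le`).

On the good event the final `V'` is a union of true clusters, so the output is a clustering whose
intra-cluster weight is at least that of the truth. For `p < 1/2` the likelihood increases with this
weight, which gives (i) and (ii). A true cluster that is not active at the end has fewer than `2 *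
l` vertices, which gives (iii). -/

namespace FaultyOracle

/-! ### Exponential moments of the answers -/

/-- The value `+1` of the answer "yes" and `-1` of the answer "no". -/
def sgn (b : Bool) : ℝ := if b = true then 1 else -1

lemma sgn_not (b : Bool) : sgn (!b) = -sgn b := by cases b <;> simp [sgn]

/-- Hoeffding's lemma: a variable in `[-1, 1]` is sub-Gaussian around its mean, here `1 - 2p`, with
variance proxy `1`. -/
lemma two_point_mgf_le (p : unitInterval) (t : ℝ) :
    (p : ℝ) * Real.exp (-t) + (1 - p) * Real.exp t
      ≤ Real.exp (t * (1 - 2 * p) + t ^ 2 / 2) := by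
  let ν : Measure ℝ := ProbabilityTheory.bernoulliMeasure (-1 : ℝ) 1 p
  have hb : ∀ᵐ x ∂ν, id x ∈ Set.Icc (-1 : ℝ) 1 := by
    have : ν (Set.Icc (-1 : ℝ) 1)ᶜ = 0 := by
      apply ProbabilityTheory.bernoulliMeasure_apply_of_notMem_of_notMem
      · exact measurableSet_Icc.compl
      · simp
      · simp
    exact this
  have h := (ProbabilityTheory.hasSubgaussianMGF_of_mem_Icc (μ := ν) (X := id)
    aemeasurable_id hb).mgf_le t
  have hmean : (∫ x, id x ∂ν) = 1 - 2 * (p : ℝ) := by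
    simp only [ν, ProbabilityTheory.integral_bernoulliMeasure, id, smul_eq_mul]
    ring
  simp only [ProbabilityTheory.mgf] at h
  rw [hmean] at h
  simp only [ν, ProbabilityTheory.integral_bernoulliMeasure, id, smul_eq_mul] at h
  have hc : (((‖(1 : ℝ) - -1‖₊ / 2) ^ 2 : NNReal) : ℝ) = 1 := by
    norm_num
  rw [hc, one_mul] at h
  calc (p : ℝ) * Real.exp (-t) + (1 - p) * Real.exp t
      = (p * Real.exp (t * (-1 - (1 - 2 * p))) + (1 - p) * Real.exp (t * (1 - (1 - 2 * p))))
        * Real.exp (t * (1 - 2 * p)) := by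
        rw [add_mul, mul_assoc, mul_assoc, ← Real.exp_add, ← Real.exp_add]
        ring_nf
    _ ≤ Real.exp (t ^ 2 / 2) * Real.exp (t * (1 - 2 * p)) :=
        mul_le_mul_of_nonneg_right h (Real.exp_pos _).le
    _ = _ := by rw [← Real.exp_add, add_comm]

instance {n : ℕ} (p : unitInterval) (T : Clustering n) : IsProbabilityMeasure (oracleLaw p T) := by
  unfold oracleLaw; infer_instance

/-- A Chernoff bound for signed sums of the answers. -/
lemma oracleLaw_sum_nonneg_le {n : ℕ} (p : unitInterval) (T : Clustering n) (hp : (p : ℝ) ≤ 1 / 2)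
    (σ : Pair n → ℝ) :
    (oracleLaw p T).real {a | 0 ≤ ∑ e, σ e * sgn (a e)}
      ≤ Real.exp ((1 - 2 * p) ^ 2 *
          ((∑ e, σ e * sgn (truth T e)) / 2 + (∑ e, σ e ^ 2) / 8)) := by
  -- A fixed `t`, half the best value for the case where every term has expected sign `-1` and `σ =
  -- ±1`. It keeps the exponent affine in the two sums, so that it can be evaluated exactly from
  -- cardinalities.
  set t : ℝ := (1 - 2 * p) / 2 with ht
  have ht0 : 0 ≤ t := by rw [ht]; linarith
  have hint : Integrable (fun a : Answers n => Real.exp (t * ∑ e, σ e * sgn (a e)))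
      (oracleLaw p T) := Integrable.of_finite
  have h1 := mul_meas_ge_le_integral_of_nonneg (μ := oracleLaw p T)
    (f := fun a : Answers n => Real.exp (t * ∑ e, σ e * sgn (a e)))
    (ae_of_all _ fun a => (Real.exp_pos _).le) hint 1
  rw [one_mul] at h1
  have h2 : (oracleLaw p T).real {a | 0 ≤ ∑ e, σ e * sgn (a e)} ≤
      (oracleLaw p T).real {a | 1 ≤ Real.exp (t * ∑ e, σ e * sgn (a e))} := by
    apply measureReal_mono
    · intro a ha
      exact Real.one_le_exp (mul_nonneg ht0 ha)
    · exact measure_ne_top _ _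
  refine (h2.trans h1).trans ?_
  have h3 : ∀ a : Answers n, Real.exp (t * ∑ e, σ e * sgn (a e))
      = ∏ e, Real.exp (t * σ e * sgn (a e)) := by
    intro a
    rw [← Real.exp_sum, Finset.mul_sum]
    simp only [mul_assoc]
  simp only [h3]
  unfold oracleLaw
  rw [integral_fintype_prod_eq_prod (f := fun e (b : Bool) => Real.exp (t * σ e * sgn b))]
  have h4 : (1 - 2 * (p : ℝ)) ^ 2 *
          ((∑ e, σ e * sgn (truth T e)) / 2 + (∑ e, σ e ^ 2) / 8)
      = ∑ e, ((t * σ e * sgn (truth T e)) * (1 - 2 * p) +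
          (t * σ e * sgn (truth T e)) ^ 2 / 2) := by
    have hs : ∀ e, sgn (truth T e) ^ 2 = 1 := by
      intro e; cases truth T e <;> simp [sgn]
    rw [Finset.sum_div, Finset.sum_div, ← Finset.sum_add_distrib, Finset.mul_sum]
    refine Finset.sum_congr rfl fun e _ => ?_
    rw [mul_pow, hs, ht]; ring
  rw [h4, Real.exp_sum]
  refine Finset.prod_le_prod (fun e _ => integral_nonneg fun _ => (Real.exp_pos _).le)
    fun e _ => ?_
  rw [ProbabilityTheory.integral_bernoulliMeasure]
  simp only [smul_eq_mul, sgn_not, mul_neg]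
  exact two_point_mgf_le p _

/-! ### Weights of vertex sets as signed sums over pairs -/

open Classical in
/-- Indicator of the pairs inside `S`. -/
noncomputable def ind {n : ℕ} (S : Finset (Fin n)) (e : Pair n) : ℝ :=
  if ∀ x ∈ e.1, x ∈ S then 1 else 0

lemma sum_offDiag_univ_eq {n : ℕ} (F : Sym2 (Fin n) → ℝ) :
    ∑ x ∈ (Finset.univ : Finset (Fin n)).offDiag, F s(x.1, x.2) = 2 * ∑ e : Pair n, F e.1 := by
  classical
  have h1 : ∑ e : Pair n, F e.1 = ∑ e ∈ Finset.univ.filter (fun e : Sym2 (Fin n) => ¬ e.IsDiag),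
      F e := by
    rw [Finset.sum_subtype (p := fun e : Sym2 (Fin n) => ¬ e.IsDiag)
      (Finset.univ.filter (fun e : Sym2 (Fin n) => ¬ e.IsDiag)) (by simp)]
  rw [h1, Finset.mul_sum]
  rw [← Finset.sum_fiberwise_of_maps_to (s := (Finset.univ : Finset (Fin n)).offDiag)
    (t := Finset.univ.filter (fun e : Sym2 (Fin n) => ¬ e.IsDiag)) (g := fun x => s(x.1, x.2))]
  · refine Finset.sum_congr rfl fun e he => ?_
    induction e with
    | h u v =>
      have huv : u ≠ v := by simpa using he
      have : (Finset.univ : Finset (Fin n)).offDiag.filter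
          (fun x => s(x.1, x.2) = s(u, v)) = {(u, v), (v, u)} := by
        ext ⟨x, y⟩
        simp only [Finset.mem_filter, Finset.mem_offDiag, Finset.mem_univ, true_and, Sym2.eq_iff,
          Finset.mem_insert, Finset.mem_singleton, Prod.mk.injEq]
        constructor
        · exact fun h => h.2
        · rintro (⟨rfl, rfl⟩ | ⟨rfl, rfl⟩)
          · exact ⟨huv, Or.inl ⟨rfl, rfl⟩⟩
          · exact ⟨huv.symm, Or.inr ⟨rfl, rfl⟩⟩
      rw [this, Finset.sum_pair (by simp [huv])]
      simp only [Sym2.eq_swap (a := v)]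
      ring
  · intro x hx
    simpa using hx

lemma sum_offDiag_eq {n : ℕ} (S : Finset (Fin n)) (F : Sym2 (Fin n) → ℝ) :
    ∑ x ∈ S.offDiag, F s(x.1, x.2) = 2 * ∑ e : Pair n, ind S e * F e.1 := by
  classical
  have h := sum_offDiag_univ_eq (fun e => if ∀ x ∈ e, x ∈ S then F e else 0)
  simp only [ind, ite_mul, one_mul, zero_mul]
  rw [← h, ← Finset.sum_filter]
  refine Finset.sum_congr ?_ fun _ _ => rfl
  ext ⟨x, y⟩
  simp
  tauto

/-- The answers as a function on all unordered pairs, with value `0` on the diagonal. -/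
noncomputable def extendSgn {n : ℕ} (a : Answers n) (e : Sym2 (Fin n)) : ℝ :=
  if h : e.IsDiag then 0 else sgn (a ⟨e, h⟩)

lemma extendSgn_pair {n : ℕ} (a : Answers n) (e : Pair n) : extendSgn a e.1 = sgn (a e) := by
  simp [extendSgn, e.2]

lemma weight_cast {n : ℕ} (a : Answers n) (u v : Fin n) :
    (weight a u v : ℝ) = extendSgn a s(u, v) := by
  by_cases h : u = v
  · simp [weight, extendSgn, h]
  · simp only [weight, h, dif_neg, not_false_eq_true, extendSgn, Sym2.mk_isDiag_iff, sgn]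
    split_ifs <;> simp

lemma weight_symm {n : ℕ} (a : Answers n) (u v : Fin n) : weight a u v = weight a v u := by
  have h : (weight a u v : ℝ) = weight a v u := by
    rw [weight_cast, weight_cast, Sym2.eq_swap]
  exact_mod_cast h

lemma inner_weight_cast {n : ℕ} (a : Answers n) (S : Finset (Fin n)) :
    (inner (weight a) S : ℝ) = 2 * ∑ e : Pair n, ind S e * sgn (a e) := by
  simp only [inner, Int.cast_sum, weight_cast]
  rw [sum_offDiag_eq S (extendSgn a)]
  simp only [extendSgn_pair]

lemma truth_mk {n : ℕ} (T : Clustering n) {u v : Fin n} (h : ¬ s(u, v).IsDiag) :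
    truth T ⟨s(u, v), h⟩ = true ↔ ∃ C ∈ T.parts, u ∈ C ∧ v ∈ C := by
  simp [truth]

/-- Over all ordered pairs in `S ×ˢ S` the true sign is `2 * [same cluster] - 1`, which sums to `2 *
∑ |S ∩ C|² - |S|²`; the diagonal accounts for `|S|` of this. -/
lemma sum_sgn_truth_offDiag {n : ℕ} (T : Clustering n) (S : Finset (Fin n)) :
    2 * ∑ e : Pair n, ind S e * sgn (truth T e)
      = 2 * ∑ C ∈ T.parts, ((S ∩ C).card : ℝ) ^ 2 - (S.card : ℝ) ^ 2 - S.card := by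
  classical
  let K : Fin n × Fin n → ℝ := fun x =>
    2 * (if ∃ C ∈ T.parts, x.1 ∈ C ∧ x.2 ∈ C then 1 else 0) - 1
  have hK : ∀ x ∈ S.offDiag, extendSgn (truth T) s(x.1, x.2) = K x := by
    rintro ⟨u, v⟩ hx
    have huv : u ≠ v := (Finset.mem_offDiag.1 hx).2.2
    have hd : ¬ s(u, v).IsDiag := by simpa using huv
    rw [extendSgn_pair (truth T) ⟨s(u, v), hd⟩]
    simp only [sgn, truth_mk, K]
    split_ifs <;> norm_num
  have h1 : 2 * ∑ e : Pair n, ind S e * sgn (truth T e) = ∑ x ∈ S.offDiag, K x := by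
    have := sum_offDiag_eq S (extendSgn (truth T))
    simp only [extendSgn_pair] at this
    rw [← this]
    exact Finset.sum_congr rfl hK
  have h2 : ∑ x ∈ S ×ˢ S, K x = ∑ x ∈ S.diag, K x + ∑ x ∈ S.offDiag, K x := by
    rw [← Finset.diag_union_offDiag, Finset.sum_union (Finset.disjoint_diag_offDiag S)]
  have h3 : ∑ x ∈ S.diag, K x = S.card := by
    rw [Finset.sum_diag]
    have : ∀ x ∈ S, K (x, x) = 1 := by
      intro x _
      have : ∃ C ∈ T.parts, x ∈ C ∧ x ∈ C :=
        ⟨T.part x, T.part_mem.2 (Finset.mem_univ x), T.mem_part (Finset.mem_univ x),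
          T.mem_part (Finset.mem_univ x)⟩
      simp only [K, if_pos this]; norm_num
    rw [Finset.sum_congr rfl this]; simp
  have h4 : ∑ x ∈ S ×ˢ S, K x = 2 * ∑ C ∈ T.parts, ((S ∩ C).card : ℝ) ^ 2 - (S.card : ℝ) ^ 2 := by
    have hind : ∀ x : Fin n × Fin n, (if ∃ C ∈ T.parts, x.1 ∈ C ∧ x.2 ∈ C then (1 : ℝ) else 0)
        = ∑ C ∈ T.parts, if x.1 ∈ C ∧ x.2 ∈ C then (1 : ℝ) else 0 := by
      intro x
      split_ifs with hx
      · obtain ⟨C, hC, hxC⟩ := hx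
        rw [Finset.sum_eq_single C]
        · rw [if_pos hxC]
        · intro D hD hDC
          rw [if_neg]
          intro hxD
          exact hDC (T.eq_of_mem_parts hD hC hxD.1 hxC.1)
        · exact fun h => (h hC).elim
      · symm
        refine Finset.sum_eq_zero fun C hC => ?_
        rw [if_neg]
        exact fun h => hx ⟨C, hC, h⟩
    simp only [K, hind, Finset.sum_sub_distrib, ← Finset.mul_sum]
    rw [Finset.sum_comm]
    congr 1
    · congr 1
      refine Finset.sum_congr rfl fun C _ => ?_
      rw [← Finset.sum_filter, ← Finset.filter_mem_eq_inter, Finset.filter_product, sq]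
      simp
    · simp [sq]
  rw [h1]
  linarith

lemma sum_ind {n : ℕ} (S : Finset (Fin n)) :
    2 * ∑ e : Pair n, ind S e = (S.card : ℝ) ^ 2 - S.card := by
  have := sum_offDiag_eq S (fun _ => 1)
  simp only [mul_one] at this
  rw [← this, Finset.sum_const, Finset.offDiag_card, nsmul_eq_mul, mul_one,
    Nat.cast_sub (Nat.le_mul_self _), Nat.cast_mul, sq]

lemma ind_mul_ind {n : ℕ} (S B : Finset (Fin n)) (e : Pair n) :
    ind S e * ind B e = ind (S ∩ B) e := by
  classical
  simp only [ind, Finset.mem_inter, forall_and]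
  split_ifs <;> simp_all

lemma ind_sq {n : ℕ} (S : Finset (Fin n)) (e : Pair n) : ind S e ^ 2 = ind S e := by
  rw [sq, ind_mul_ind, Finset.inter_self]

/-! ### Comparing a set with a piece of a cluster -/

/-- The exponent governing the comparison of `S` with a piece of a cluster `K`: `S` meets `K` in `a`
vertices, the piece has `r` further vertices, `S` has `d` vertices outside `K`, and `q` is the sum
of the squared sizes of its intersections with the other clusters. -/
def gap (a r d q : ℝ) : ℝ := 3 * r * (2 * a + r - 1) + 3 * d * (2 * a + d) + 5 * d - 8 * q

/-- Pairs inside `S ∩ K = S ∩ B` cancel in the difference of the weights, so only the pairs inside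
exactly one of `S` and `B` enter the Chernoff bound, both in the mean and in the squared length. -/
lemma inner_le_inner_prob {n : ℕ} (p : unitInterval) (T : Clustering n) (hp : (p : ℝ) ≤ 1 / 2)
    {S B K : Finset (Fin n)} (hK : K ∈ T.parts) (hB : B ⊆ K) (hS : S ∩ K ⊆ B) :
    (oracleLaw p T).real {a | inner (weight a) B ≤ inner (weight a) S}
      ≤ Real.exp (-((1 - 2 * p) ^ 2 / 16 * gap (S ∩ K).card (B \ S).card (S \ K).card
          (∑ C ∈ T.parts.erase K, ((S ∩ C).card : ℝ) ^ 2))) := by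
  classical
  have h := oracleLaw_sum_nonneg_le p T hp (fun e => ind S e - ind B e)
  have hset : {a : Answers n | inner (weight a) B ≤ inner (weight a) S}
      = {a | 0 ≤ ∑ e, (ind S e - ind B e) * sgn (a e)} := by
    ext a
    simp only [Set.mem_ofPred_eq, sub_mul, Finset.sum_sub_distrib, sub_nonneg]
    rw [← Int.cast_le (R := ℝ), inner_weight_cast, inner_weight_cast]
    constructor <;> intro h <;> linarith
  rw [hset]
  refine h.trans (le_of_eq ?_)
  congr 1
  have hSB : S ∩ B = S ∩ K := by
    apply Finset.Subset.antisymm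
    · exact Finset.inter_subset_inter_left hB
    · exact Finset.subset_inter Finset.inter_subset_left hS
  have e1 : 2 * ∑ e : Pair n, (ind S e - ind B e) * sgn (truth T e)
      = (2 * ∑ C ∈ T.parts, ((S ∩ C).card : ℝ) ^ 2 - (S.card : ℝ) ^ 2 - S.card)
        - ((B.card : ℝ) ^ 2 - B.card) := by
    have hBs : ∑ C ∈ T.parts, ((B ∩ C).card : ℝ) ^ 2 = (B.card : ℝ) ^ 2 := by
      rw [Finset.sum_eq_single K]
      · rw [Finset.inter_eq_left.2 hB]
      · intro D hD hDK
        have : B ∩ D = ∅ := by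
          rw [← Finset.disjoint_iff_inter_eq_empty]
          exact (T.disjoint hK hD hDK.symm).mono_left hB
        simp [this]
      · exact fun h => (h hK).elim
    simp only [sub_mul, Finset.sum_sub_distrib, mul_sub]
    rw [sum_sgn_truth_offDiag, sum_sgn_truth_offDiag, hBs]
    ring
  have e2 : 2 * ∑ e : Pair n, (ind S e - ind B e) ^ 2
      = ((S.card : ℝ) ^ 2 - S.card) + ((B.card : ℝ) ^ 2 - B.card)
        - 2 * (((S ∩ K).card : ℝ) ^ 2 - (S ∩ K).card) := by
    have : ∀ e : Pair n, (ind S e - ind B e) ^ 2 = ind S e + ind B e - 2 * ind (S ∩ K) e := by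
      intro e
      rw [← hSB, ← ind_mul_ind]
      linear_combination ind_sq S e + ind_sq B e
    simp only [this, Finset.sum_sub_distrib, Finset.sum_add_distrib, ← Finset.mul_sum]
    rw [← sum_ind S, ← sum_ind B, ← sum_ind (S ∩ K)]
    ring
  have c1 : (S.card : ℝ) = (S ∩ K).card + (S \ K).card := by
    exact_mod_cast (Finset.card_inter_add_card_sdiff S K).symm
  have c2 : (B.card : ℝ) = (S ∩ K).card + (B \ S).card := by
    rw [← hSB, Finset.inter_comm]
    exact_mod_cast (Finset.card_inter_add_card_sdiff B S).symm
  rw [← Finset.add_sum_erase _ _ hK] at e1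
  rw [c1, c2] at e1 e2
  unfold gap
  -- With `e1` and `e2` as evaluated above (twice the sums over pairs), the Chernoff exponent is `(1
  -- - 2p)² * (e1 / 4 + e2 / 16)`, and `gap` is `-(4 * e1 + e2)`.
  linear_combination (1 - 2 * (p : ℝ)) ^ 2 * (e1 / 4 + e2 / 16)

/-! ### The gap against the entropy of the union bound -/

/-- What the `x` vertices of `S` in one other cluster contribute to the gap. The bracket is at least
`l / 2`, whichever of `a` and `d` is larger, and this suffices from `x = 3` on; smaller `x` are
direct. -/
lemma part_term_ge {a d l : ℝ} (hl : 1000 ≤ l) (h : l ≤ a + d) {x : ℕ} (hx : 1 ≤ x)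
    (hxa : (x : ℝ) ≤ a) (hxd : (x : ℝ) ≤ d) :
    l * (1 + x / 6) ≤ x * (6 * a + 3 * d + 5 - 8 * x) := by
  rcases Nat.lt_or_ge x 3 with h3 | h3
  · interval_cases x
    · push_cast at *; linarith
    · push_cast at *; linarith
  · have h3' : (3 : ℝ) ≤ x := by exact_mod_cast h3
    have h1 : l / 2 ≤ 6 * a + 3 * d + 5 - 8 * x := by
      rcases le_total a d with had | had <;> linarith
    calc l * (1 + x / 6) ≤ x * (l / 2) := by nlinarith
      _ ≤ _ := mul_le_mul_of_nonneg_left h1 (by linarith)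

/-- Splits the part of `gap` due to the vertices outside `K` into one term per other cluster, so
that it can be compared with a cost per cluster. -/
lemma sum_mul_sub_sq {ι : Type*} (s : Finset ι) (x : ι → ℕ) (a d : ℝ)
    (hd : ∑ i ∈ s, (x i : ℝ) = d) :
    ∑ i ∈ s, (x i : ℝ) * (6 * a + 3 * d + 5 - 8 * x i)
      = 3 * d * (2 * a + d) + 5 * d - 8 * ∑ i ∈ s, (x i : ℝ) ^ 2 := by
  have : ∀ i ∈ s, (x i : ℝ) * (6 * a + 3 * d + 5 - 8 * x i)
      = x i * (6 * a + 3 * d + 5) - 8 * (x i : ℝ) ^ 2 := fun i _ => by ring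
  rw [Finset.sum_congr rfl this, Finset.sum_sub_distrib, ← Finset.sum_mul, hd, ← Finset.mul_sum]
  ring

lemma sum_cost {ι : Type*} (s : Finset ι) (x : ι → ℕ) (η d : ℝ)
    (hd : ∑ i ∈ s, (x i : ℝ) = d) :
    ∑ i ∈ s, (if x i = 0 then (0 : ℝ) else 1 + η * x i)
      = (s.filter fun i => x i ≠ 0).card + η * d := by
  rw [← hd, Finset.mul_sum, Finset.card_filter]
  push_cast
  rw [← Finset.sum_add_distrib]
  refine Finset.sum_congr rfl fun i _ => ?_
  by_cases h : x i = 0 <;> simp [h]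

lemma card_filter_le_sum {ι : Type*} (s : Finset ι) (x : ι → ℕ) (d : ℝ)
    (hd : ∑ i ∈ s, (x i : ℝ) = d) : ((s.filter fun i => x i ≠ 0).card : ℝ) ≤ d := by
  rw [← hd, Finset.card_filter]
  push_cast
  refine Finset.sum_le_sum fun i _ => ?_
  split_ifs with h
  · exact_mod_cast Nat.one_le_iff_ne_zero.2 h
  · positivity

/-- The gap beats the cost of the union bound, for a set `S` of size at least `l` that differs from
the piece of the cluster in which it has the most vertices. -/
lemma gap_ge_of_large {ι : Type*} (s : Finset ι) (x : ι → ℕ) (a r d : ℕ) (l : ℝ) (hl : 1000 ≤ l)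
    (hd : ∑ i ∈ s, x i = d) (hxa : ∀ i ∈ s, x i ≤ a) (had : l ≤ a + d) (hdr : d ≠ 0 ∨ r ≠ 0) :
    l * (3 + r / 24 + ((s.filter fun i => x i ≠ 0).card + 1 / 24 * d))
      ≤ gap a r d (∑ i ∈ s, (x i : ℝ) ^ 2) := by
  have hd' : ∑ i ∈ s, (x i : ℝ) = d := by exact_mod_cast hd
  have hxd : ∀ i ∈ s, x i ≤ d := fun i hi => hd ▸ Finset.single_le_sum (fun _ _ => Nat.zero_le _) hi
  have hr0 : (0 : ℝ) ≤ r := Nat.cast_nonneg r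
  have ha0 : (0 : ℝ) ≤ a := Nat.cast_nonneg a
  have hk := card_filter_le_sum s x d hd'
  have hkey := sum_mul_sub_sq s x a d hd'
  unfold gap
  set k : ℝ := (((s.filter fun i => x i ≠ 0).card : ℕ) : ℝ)
  set q := ∑ i ∈ s, (x i : ℝ) ^ 2
  have hrr : (0 : ℝ) ≤ r * (r - 1) := by
    rcases Nat.eq_zero_or_pos r with h | h
    · simp [h]
    · have : (1 : ℝ) ≤ r := by exact_mod_cast h
      nlinarith
  rcases Nat.eq_zero_or_pos d with hd0 | hdpos
  · have hr1 : (1 : ℝ) ≤ r := by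
      have : r ≠ 0 := by tauto
      exact_mod_cast Nat.one_le_iff_ne_zero.2 this
    have hd0' : (d : ℝ) = 0 := by exact_mod_cast hd0
    have hq : q = 0 := by
      refine Finset.sum_eq_zero fun i hi => ?_
      have : x i = 0 := by have := hxd i hi; omega
      simp [this]
    rw [hd0'] at had hk ⊢
    rw [hq]
    have h1 : 6 * r * l ≤ 3 * r * (2 * a + r - 1) := by nlinarith
    have h2 : l * (3 + r / 24) ≤ 6 * r * l := by nlinarith
    have h3 : l * k ≤ 0 := mul_nonpos_of_nonneg_of_nonpos (by linarith) hk
    linarith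
  have hd1 : (1 : ℝ) ≤ d := by exact_mod_cast hdpos
  -- From `d = 48` on, `l * d / 16` covers the constant `3 * l`. Below, each outside vertex is worth
  -- at least `6 * l - 11 * d + 5 ≥ 5 * l`, because `1000 ≤ l`.
  rcases lt_or_ge d 48 with h48 | h48
  · have h48' : (d : ℝ) ≤ 47 := by exact_mod_cast (by omega : d ≤ 47)
    have h1 : ∑ i ∈ s, (x i : ℝ) * (5 * l) ≤
        ∑ i ∈ s, (x i : ℝ) * (6 * a + 3 * d + 5 - 8 * x i) := by
      refine Finset.sum_le_sum fun i hi => ?_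
      have : (x i : ℝ) ≤ d := by exact_mod_cast hxd i hi
      refine mul_le_mul_of_nonneg_left ?_ (Nat.cast_nonneg _)
      linarith
    rw [← Finset.sum_mul, hd', hkey] at h1
    have h2 : (r : ℝ) * (l / 24) ≤ r * (3 * (2 * a + r - 1)) :=
      by nlinarith
    have h3 : l * (3 + (k + 1 / 24 * d)) ≤ d * (5 * l) := by nlinarith
    linarith
  · have h48' : (48 : ℝ) ≤ d := by exact_mod_cast h48
    have h1 : ∑ i ∈ s, l * (if x i = 0 then (0 : ℝ) else 1 + 1 / 6 * x i) ≤
        ∑ i ∈ s, (x i : ℝ) * (6 * a + 3 * d + 5 - 8 * x i) := by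
      refine Finset.sum_le_sum fun i hi => ?_
      split_ifs with h0
      · simp [h0]
      · have := part_term_ge hl had (Nat.one_le_iff_ne_zero.2 h0)
          (by exact_mod_cast hxa i hi) (by exact_mod_cast hxd i hi)
        calc l * (1 + 1 / 6 * (x i : ℝ)) = l * (1 + x i / 6) := by ring
          _ ≤ _ := this
    rw [← Finset.mul_sum, sum_cost s x _ d hd', hkey] at h1
    -- If `2a + r - 1` is at least `l / 72`, the missing vertices pay for themselves. Otherwise `a`
    -- and `r` are small, so `l ≤ a + d` forces `r ≤ d` and the outside vertices can pay.
    have h2 : l * r / 24 ≤ l * d / 16 + 3 * r * (2 * a + r - 1) := by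
      rcases le_total (l / 72) (2 * a + r - 1) with h | h
      · have : (r : ℝ) * (l / 72) ≤ r * (2 * a + r - 1) := mul_le_mul_of_nonneg_left h hr0
        have : 0 ≤ l * d := by positivity
        linarith
      · have h4 : (r : ℝ) ≤ d := by linarith
        have h5 : l * r ≤ l * d := mul_le_mul_of_nonneg_left h4 (by linarith)
        have h6 : (0 : ℝ) ≤ r * a := by positivity
        have h7 : 0 ≤ l * d := by positivity
        linarith
    have h3 : l * 3 ≤ l * d / 16 := by nlinarith
    linarith

/-- The gap beats the cost of the union bound, for a set `S` of size less than `l` and a piece of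
size `2 * l`. -/
lemma gap_ge_of_small {ι : Type*} (s : Finset ι) (x : ι → ℕ) (a r d l : ℕ) (hl : 1000 ≤ l)
    (hd : ∑ i ∈ s, x i = d) (had : a + d < l) (har : a + r = 2 * l) :
    (l : ℝ) * (3 + r / 24 + ((s.filter fun i => x i ≠ 0).card + 1 / 24 * d))
      ≤ gap a r d (∑ i ∈ s, (x i : ℝ) ^ 2) := by
  have hd' : ∑ i ∈ s, (x i : ℝ) = d := by exact_mod_cast hd
  have hk := card_filter_le_sum s x d hd'
  have hq : ∑ i ∈ s, (x i : ℝ) ^ 2 ≤ (d : ℝ) ^ 2 := by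
    rw [← hd']
    exact Finset.sum_sq_le_sq_sum_of_nonneg fun _ _ => Nat.cast_nonneg _
  unfold gap
  set k : ℝ := (((s.filter fun i => x i ≠ 0).card : ℕ) : ℝ)
  set q := ∑ i ∈ s, (x i : ℝ) ^ 2
  have hl' : (1000 : ℝ) ≤ l := by exact_mod_cast hl
  have ha0 : (0 : ℝ) ≤ a := Nat.cast_nonneg a
  have hd0 : (0 : ℝ) ≤ d := Nat.cast_nonneg d
  have had' : (a : ℝ) + d ≤ l := by exact_mod_cast had.le
  have hr : (r : ℝ) = 2 * l - a := by
    have : (a : ℝ) + r = 2 * l := by exact_mod_cast har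
    linarith
  rw [hr]
  -- The cost is at most `2 * l²`. The piece has so many more vertices than `S` that `3 * r * (2a +
  -- r - 1)`, about `12 * l² - 3 * a²`, outweighs both this and the loss `8 * q ≤ 8 * d²`.
  have h1 : (l : ℝ) * (3 + (2 * l - a) / 24 + (k + 1 / 24 * d)) ≤ l * (2 * l) := by
    apply mul_le_mul_of_nonneg_left _ (by linarith)
    linarith
  have h2 : (a : ℝ) * a ≤ l * a := by nlinarith
  have h3 : (d : ℝ) * d ≤ l * (l - a) := by nlinarith
  have h4 : (0 : ℝ) ≤ a * d := by positivity
  nlinarith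

/-! ### The union bound over critical sets -/

/-- The sets `S` that could mislead the extraction from (a part of) the vertex set `P` with regard
to the cluster `K`. -/
def Critical {n : ℕ} (T : Clustering n) (l : ℕ) (P K S : Finset (Fin n)) : Prop :=
  S ⊆ P ∧ (∀ C ∈ T.parts, (S ∩ C).Nonempty → (C ∩ P).card ≤ 2 * l) ∧ (K ∩ P).card ≤ 2 * l ∧
    ((l ≤ S.card ∧ S ≠ K ∩ P ∧ ∀ C ∈ T.parts, (S ∩ C).card ≤ (S ∩ K).card) ∨
      ((K ∩ P).card = 2 * l ∧ S.card < l))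

/-- The clusters cover all vertices, so `S` is determined by its traces `S ∩ C`; expanding the
product on the right gives every admissible family of traces once. -/
lemma sum_prod_inter_le {n : ℕ} (T : Clustering n) (G : Finset (Finset (Fin n)))
    (F : Finset (Fin n) → Finset (Finset (Fin n))) (f : Finset (Fin n) → Finset (Fin n) → ℝ)
    (hf : ∀ C A, 0 ≤ f C A) (hG : ∀ S ∈ G, ∀ C ∈ T.parts, S ∩ C ∈ F C) :
    ∑ S ∈ G, ∏ C ∈ T.parts, f C (S ∩ C) ≤ ∏ C ∈ T.parts, ∑ A ∈ F C, f C A := by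
  classical
  rw [← Finset.prod_coe_sort T.parts, Finset.prod_univ_sum]
  let g : Finset (Fin n) → (T.parts → Finset (Fin n)) := fun S C => S ∩ C
  have hg : Function.Injective g := by
    intro S S' h
    ext x
    have hx : T.part x ∈ T.parts := T.part_mem.2 (Finset.mem_univ x)
    have h1 : S ∩ T.part x = S' ∩ T.part x := congrFun h ⟨T.part x, hx⟩
    have h2 : x ∈ T.part x := T.mem_part (Finset.mem_univ x)
    have h3 := Finset.ext_iff.1 h1 x
    simpa [h2] using h3
  calc ∑ S ∈ G, ∏ C ∈ T.parts, f C (S ∩ C)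
      = ∑ x ∈ G.image g, ∏ C : T.parts, f C (x C) := by
        rw [Finset.sum_image hg.injOn]
        refine Finset.sum_congr rfl fun S _ => ?_
        rw [← Finset.prod_coe_sort T.parts]
    _ ≤ _ := by
        refine Finset.sum_le_sum_of_subset_of_nonneg ?_ fun _ _ _ =>
          Finset.prod_nonneg fun _ _ => hf _ _
        intro x hx
        obtain ⟨S, hS, rfl⟩ := Finset.mem_image.1 hx
        rw [Fintype.mem_piFinset]
        exact fun C => hG S hS C C.2

lemma sum_powerset_exp_card_sdiff {α : Type*} [DecidableEq α] (B : Finset α) (u : ℝ) :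
    ∑ A ∈ B.powerset, Real.exp (-(u * (B \ A).card)) = (1 + Real.exp (-u)) ^ B.card := by
  rw [← Finset.sum_pow_mul_eq_add_pow]
  refine Finset.sum_congr rfl fun A hA => ?_
  rw [one_pow, one_mul, Finset.card_sdiff_of_subset (Finset.mem_powerset.1 hA), ← Real.exp_nat_mul]
  congr 1; ring

lemma sum_powerset_exp_card {α : Type*} (B : Finset α) (u : ℝ) :
    ∑ A ∈ B.powerset, Real.exp (-(u * A.card)) = (1 + Real.exp (-u)) ^ B.card := by
  rw [add_comm, ← Finset.sum_pow_mul_eq_add_pow]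
  refine Finset.sum_congr rfl fun A _ => ?_
  rw [one_pow, mul_one, ← Real.exp_nat_mul]
  congr 1; ring

/-- The exponent spent per cluster `C` in the union bound over the critical sets. -/
noncomputable def cost {n : ℕ} (K B C A : Finset (Fin n)) : ℝ :=
  if C = K then (B \ A).card / 24 else if A.card = 0 then 0 else 1 + 1 / 24 * A.card

lemma sum_cost_inter {n : ℕ} (T : Clustering n) {K B : Finset (Fin n)} (hK : K ∈ T.parts)
    (hB : B ⊆ K) (S : Finset (Fin n)) :
    ∑ C ∈ T.parts, cost K B C (S ∩ C) = (B \ S).card / 24 +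
      ∑ C ∈ T.parts.erase K, if (S ∩ C).card = 0 then (0 : ℝ) else 1 + 1 / 24 * (S ∩ C).card := by
  classical
  rw [← Finset.add_sum_erase _ _ hK]
  congr 1
  · rw [cost, if_pos rfl]
    congr 3
    ext x
    simp only [Finset.mem_sdiff, Finset.mem_inter]
    constructor
    · exact fun h => ⟨h.1, fun hx => h.2 ⟨hx, hB h.1⟩⟩
    · exact fun h => ⟨h.1, fun hx => h.2 hx.1⟩
  · refine Finset.sum_congr rfl fun C hC => ?_
    rw [cost, if_neg (Finset.ne_of_mem_erase hC)]

lemma sum_card_inter_erase {n : ℕ} (T : Clustering n) {K : Finset (Fin n)} (hK : K ∈ T.parts)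
    (S : Finset (Fin n)) : ∑ C ∈ T.parts.erase K, (S ∩ C).card = (S \ K).card := by
  classical
  have h1 : ∑ C ∈ T.parts, (S ∩ C).card = S.card := by
    have hU : T.parts.biUnion (fun C => S ∩ C) = S := by
      rw [← Finset.inter_biUnion]
      exact (congrArg (S ∩ ·) T.biUnion_parts).trans (Finset.inter_univ S)
    rw [← Finset.card_biUnion, hU]
    · intro C hC D hD hCD
      exact (T.disjoint hC hD hCD).mono Finset.inter_subset_right Finset.inter_subset_right
  rw [← Finset.add_sum_erase _ _ hK, ← Finset.card_inter_add_card_sdiff S K] at h1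
  omega

/-- Turns the gap inequality into a product over clusters, the form needed for factoring the sum
over `S`. The spare factor `exp (-3L)` pays later for the choice of the prefix and of `K`. -/
lemma critical_prob_le {n : ℕ} (p : unitInterval) (T : Clustering n) (hp : (p : ℝ) ≤ 1 / 2)
    {L : ℝ} {l : ℕ} (hl : 1000 ≤ l) (hlL : 16 * L ≤ (1 - 2 * p) ^ 2 * l)
    {P K S : Finset (Fin n)} (hK : K ∈ T.parts) (hS : Critical T l P K S) :
    (oracleLaw p T).real {a | inner (weight a) (K ∩ P) ≤ inner (weight a) S}
      ≤ Real.exp (-(3 * L)) * ∏ C ∈ T.parts, Real.exp (-(L * cost K (K ∩ P) C (S ∩ C))) := by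
  classical
  have hl0 : (0 : ℝ) < l := by exact_mod_cast (by omega : 0 < l)
  have hl' : (1000 : ℝ) ≤ l := by exact_mod_cast hl
  have hsub : S ∩ K ⊆ K ∩ P := by
    rw [Finset.inter_comm]
    exact Finset.inter_subset_inter_left hS.1
  refine (inner_le_inner_prob p T hp hK Finset.inter_subset_left hsub).trans ?_
  rw [← Real.exp_sum, ← Real.exp_add]
  refine Real.exp_le_exp.2 ?_
  rw [Finset.sum_neg_distrib, ← Finset.mul_sum, sum_cost_inter T hK Finset.inter_subset_left]
  have hd := sum_card_inter_erase T hK S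
  have hd' : ∑ C ∈ T.parts.erase K, ((S ∩ C).card : ℝ) = (S \ K).card := by exact_mod_cast hd
  rw [sum_cost _ (fun C => (S ∩ C).card) _ _ hd']
  have hSc := Finset.card_inter_add_card_sdiff S K
  have hgap : (l : ℝ) * (3 + ((K ∩ P) \ S).card / 24 +
      (((T.parts.erase K).filter fun C => (S ∩ C).card ≠ 0).card + 1 / 24 * (S \ K).card))
      ≤ gap (S ∩ K).card ((K ∩ P) \ S).card (S \ K).card
          (∑ C ∈ T.parts.erase K, ((S ∩ C).card : ℝ) ^ 2) := by
    obtain ⟨hSP, -, -, ⟨h1, h2, h3⟩ | ⟨h1, h2⟩⟩ := hS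
    · refine gap_ge_of_large _ _ _ _ _ _ hl' hd
        (fun C hC => h3 C (Finset.mem_of_mem_erase hC)) ?_ ?_
      · exact_mod_cast hSc ▸ h1
      · by_contra! hcon
        apply h2
        rw [Finset.card_eq_zero, Finset.card_eq_zero, Finset.sdiff_eq_empty_iff_subset,
          Finset.sdiff_eq_empty_iff_subset] at hcon
        exact Finset.Subset.antisymm (Finset.subset_inter hcon.1 hSP) hcon.2
    · refine gap_ge_of_small _ _ _ _ _ _ hl hd (hSc ▸ h2) ?_
      rw [← h1, ← Finset.card_inter_add_card_sdiff (K ∩ P) S]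
      congr 2
      ext x
      simp only [Finset.mem_inter]
      constructor
      · exact fun h => ⟨⟨h.2, hSP h.1⟩, h.1⟩
      · exact fun h => ⟨h.2, h.1.1⟩
  set c : ℝ := 3 + ((K ∩ P) \ S).card / 24 +
      (((T.parts.erase K).filter fun C => (S ∩ C).card ≠ 0).card + 1 / 24 * (S \ K).card) with hc
  set g := gap (S ∩ K).card ((K ∩ P) \ S).card (S \ K).card
          (∑ C ∈ T.parts.erase K, ((S ∩ C).card : ℝ) ^ 2)
  have hc0 : 0 ≤ c := by positivity
  have h1 : L * c ≤ (1 - 2 * (p : ℝ)) ^ 2 / 16 * g := by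
    have h2 : L ≤ (1 - 2 * (p : ℝ)) ^ 2 / 16 * l := by linarith
    calc L * c ≤ ((1 - 2 * (p : ℝ)) ^ 2 / 16 * l) * c := mul_le_mul_of_nonneg_right h2 hc0
      _ = (1 - 2 * (p : ℝ)) ^ 2 / 16 * (l * c) := by ring
      _ ≤ _ := mul_le_mul_of_nonneg_left hgap (by positivity)
  have h3 : L * c = 3 * L + L * (((K ∩ P) \ S).card / 24 +
      (((T.parts.erase K).filter fun C => (S ∩ C).card ≠ 0).card + 1 / 24 * (S \ K).card)) := by
    rw [hc]; ring
  linarith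

-- After factoring, the cluster `K` contributes at most `M`, and any other at most `1 + exp (-L) *
-- M`: the `1` stands for an empty trace and `exp (-L)` is the price of meeting the cluster at all.
-- As there are at most `n ≤ exp L` clusters, the latter multiply to at most `exp M`.
open Classical in
lemma sum_critical_prob_le {n : ℕ} (p : unitInterval) (T : Clustering n) (hp : (p : ℝ) ≤ 1 / 2)
    {L M : ℝ} {l : ℕ} (hl : 1000 ≤ l) (hlL : 16 * L ≤ (1 - 2 * p) ^ 2 * l)
    (hn : n * Real.exp (-L) ≤ 1) (hM : (1 + Real.exp (-(L / 24))) ^ (2 * l) ≤ M)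
    {P K : Finset (Fin n)} (hK : K ∈ T.parts) :
    ∑ S ∈ Finset.univ.filter (Critical T l P K),
        (oracleLaw p T).real {a | inner (weight a) (K ∩ P) ≤ inner (weight a) S}
      ≤ Real.exp (-(3 * L)) * (M * Real.exp M) := by
  by_cases hKP : (K ∩ P).card ≤ 2 * l
  swap
  · rw [Finset.filter_false_of_mem, Finset.sum_empty]
    · have : 0 ≤ M := le_trans (by positivity) hM
      positivity
    · exact fun S _ hS => hKP hS.2.2.1
  have hM0 : 0 ≤ M := le_trans (by positivity) hM
  have hMpow : ∀ m ≤ 2 * l, (1 + Real.exp (-(L / 24))) ^ m ≤ M := fun m hm =>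
    (pow_le_pow_right₀ (by linarith [Real.exp_pos (-(L / 24))]) hm).trans hM
  refine (Finset.sum_le_sum fun S hS =>
    critical_prob_le p T hp hl hlL hK (Finset.mem_filter.1 hS).2).trans ?_
  rw [← Finset.mul_sum]
  refine mul_le_mul_of_nonneg_left ?_ (Real.exp_pos _).le
  -- A critical set does not meet clusters with more than `2 * l` vertices in `P`; allowing only the
  -- empty trace there keeps every power below the bound `M`.
  let F : Finset (Fin n) → Finset (Finset (Fin n)) := fun C =>
    if (C ∩ P).card ≤ 2 * l then (C ∩ P).powerset else {∅}
  refine (sum_prod_inter_le T _ F (fun C A => Real.exp (-(L * cost K (K ∩ P) C A)))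
    (fun _ _ => (Real.exp_pos _).le) ?_).trans ?_
  · intro S hS C hC
    obtain ⟨hSP, hS2, -⟩ := (Finset.mem_filter.1 hS).2
    simp only [F]
    split_ifs with h
    · rw [Finset.mem_powerset, Finset.inter_comm]
      exact Finset.inter_subset_inter_left hSP
    · rw [Finset.mem_singleton, ← Finset.not_nonempty_iff_eq_empty]
      exact fun hne => h (hS2 C hC hne)
  rw [← Finset.mul_prod_erase _ _ hK]
  refine mul_le_mul ?_ ?_ (Finset.prod_nonneg fun _ _ => Finset.sum_nonneg fun _ _ =>
    (Real.exp_pos _).le) hM0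
  · simp only [F, if_pos hKP, cost, if_true]
    refine le_trans (le_of_eq ?_) (hMpow _ hKP)
    rw [← sum_powerset_exp_card_sdiff]
    refine Finset.sum_congr rfl fun A _ => ?_
    congr 1; ring
  · calc ∏ C ∈ T.parts.erase K, ∑ A ∈ F C, Real.exp (-(L * cost K (K ∩ P) C A))
        ≤ ∏ C ∈ T.parts.erase K, Real.exp (Real.exp (-L) * M) := by
          refine Finset.prod_le_prod (fun _ _ => Finset.sum_nonneg fun _ _ =>
            (Real.exp_pos _).le) fun C hC => ?_
          have hle : ∀ A, Real.exp (-(L * cost K (K ∩ P) C A)) ≤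
              (if A = ∅ then 1 else 0) + Real.exp (-L) * Real.exp (-(L / 24 * A.card)) := by
            intro A
            rw [cost, if_neg (Finset.ne_of_mem_erase hC)]
            rcases Finset.eq_empty_or_nonempty A with h | h
            · simp [h, (Real.exp_pos _).le]
            · rw [if_neg h.card_pos.ne', if_neg h.ne_empty, zero_add, ← Real.exp_add]
              refine le_of_eq ?_
              congr 1; ring
          have hle2 : ∑ A ∈ F C, Real.exp (-(L / 24 * A.card)) ≤ M := by
            simp only [F]
            split_ifs with h
            · rw [sum_powerset_exp_card]
              exact hMpow _ h
            · simpa using hMpow 0 (Nat.zero_le _)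
          calc ∑ A ∈ F C, Real.exp (-(L * cost K (K ∩ P) C A))
              ≤ ∑ A ∈ F C, ((if A = ∅ then 1 else 0) +
                  Real.exp (-L) * Real.exp (-(L / 24 * A.card))) :=
                Finset.sum_le_sum fun A _ => hle A
            _ ≤ 1 + Real.exp (-L) * M := by
                rw [Finset.sum_add_distrib, ← Finset.mul_sum]
                refine add_le_add ?_ (mul_le_mul_of_nonneg_left hle2 (Real.exp_pos _).le)
                rw [Finset.sum_ite_eq']
                split_ifs <;> norm_num
            _ ≤ Real.exp (Real.exp (-L) * M) := by
                rw [add_comm]; exact Real.add_one_le_exp _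
      _ = Real.exp ((T.parts.erase K).card * (Real.exp (-L) * M)) := by
          rw [Finset.prod_const, Real.exp_nat_mul]
      _ ≤ Real.exp M := by
          refine Real.exp_le_exp.2 ?_
          have hcard : ((T.parts.erase K).card : ℝ) ≤ n := by
            have h1 : (T.parts.erase K).card ≤ T.parts.card :=
              Finset.card_le_card (Finset.erase_subset _ _)
            have h2 : T.parts.card ≤ n := by simpa using T.card_parts_le_card
            exact_mod_cast h1.trans h2
          calc ((T.parts.erase K).card : ℝ) * (Real.exp (-L) * M)
              ≤ n * (Real.exp (-L) * M) := mul_le_mul_of_nonneg_right hcard (by positivity)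
            _ = (n * Real.exp (-L)) * M := by ring
            _ ≤ 1 * M := mul_le_mul_of_nonneg_right hn hM0
            _ = M := one_mul M

/-! ### Prefixes of the order and maximality of heaviest subgraphs -/

/-- The first `t` selected vertices. -/
def Choices.first {n : ℕ} (R : Choices n) (t : ℕ) : Finset (Fin n) := (R.vertices.take t).toFinset

lemma Choices.length_vertices {n : ℕ} (R : Choices n) : R.vertices.length = n := by
  simp [Choices.vertices]

lemma Choices.nodup_vertices {n : ℕ} (R : Choices n) : R.vertices.Nodup :=
  (List.nodup_finRange n).map R.order.injective

lemma Choices.getElem_vertices {n : ℕ} (R : Choices n) (t : Fin n) :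
    R.vertices[(t : ℕ)]'(by rw [R.length_vertices]; exact t.2) = R.order t := by
  simp [Choices.vertices]

lemma Choices.first_all {n : ℕ} (R : Choices n) : R.first n = Finset.univ := by
  ext x
  simp only [Choices.first, List.mem_toFinset, Finset.mem_univ, iff_true]
  rw [List.take_of_length_le R.length_vertices.le]
  simpa [Choices.vertices] using R.order.surjective x

lemma Choices.first_succ {n : ℕ} (R : Choices n) (t : Fin n) :
    R.first (t + 1) = insert (R.order t) (R.first t) := by
  have ht : (t : ℕ) < R.vertices.length := by rw [R.length_vertices]; exact t.2
  rw [Choices.first, ← List.take_append_getElem ht, List.toFinset_append, R.getElem_vertices]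
  ext x
  simp [Choices.first, or_comm]

lemma Choices.notMem_first {n : ℕ} (R : Choices n) (t : Fin n) : R.order t ∉ R.first t := by
  have ht : (t : ℕ) < R.vertices.length := by rw [R.length_vertices]; exact t.2
  have h := R.nodup_vertices.sublist (List.take_sublist (t + 1) R.vertices)
  rw [← List.take_append_getElem ht, R.getElem_vertices, List.nodup_append] at h
  simp only [Choices.first, List.mem_toFinset]
  intro hm
  exact h.2.2 _ hm _ (List.mem_singleton.2 rfl) rfl

lemma Choices.card_first_le {n : ℕ} (R : Choices n) (t : ℕ) : (R.first t).card ≤ t :=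
  (List.toFinset_card_le _).trans (by simp)

lemma inner_restrict {n : ℕ} (w : Fin n → Fin n → ℤ) {A B : Finset (Fin n)} (h : B ⊆ A) :
    inner (restrict w A) B = inner w B := by
  refine Finset.sum_congr rfl fun e he => ?_
  have he' := Finset.mem_offDiag.1 he
  rw [restrict, if_pos ⟨h he'.1, h he'.2.1⟩]

lemma inner_insert {n : ℕ} {w : Fin n → Fin n → ℤ} (hw : ∀ u v, w u v = w v u)
    {S : Finset (Fin n)} {z : Fin n} (hz : z ∉ S) :
    inner w (insert z S) = inner w S + 2 * ∑ u ∈ S, w z u := by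
  have h1 : Disjoint S.offDiag ({z} ×ˢ S) := by
    rw [Finset.disjoint_left]
    rintro ⟨x, y⟩ h h'
    simp only [Finset.mem_offDiag, Finset.mem_product, Finset.mem_singleton] at h h'
    exact hz (h'.1 ▸ h.1)
  have h2 : Disjoint (S.offDiag ∪ {z} ×ˢ S) (S ×ˢ {z}) := by
    rw [Finset.disjoint_left]
    rintro ⟨x, y⟩ h h'
    simp only [Finset.mem_union, Finset.mem_offDiag, Finset.mem_product,
      Finset.mem_singleton] at h h'
    rcases h with h | h
    · exact hz (h'.2 ▸ h.2.1)
    · exact hz (h'.2 ▸ h.2)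
  rw [inner, Finset.offDiag_insert hz, Finset.sum_union h2, Finset.sum_union h1,
    Finset.sum_product, Finset.sum_product, Finset.sum_singleton]
  simp only [Finset.sum_singleton, hw _ z]
  rw [inner]
  ring

lemma absorb_eq_self {n : ℕ} (R : Choices n) (w : Fin n → Fin n → ℤ) (S A : Finset (Fin n))
    (h : ∀ z ∈ A, ∑ u ∈ S, w z u ≤ 0) : absorb R w S A = S := by
  have key : ∀ L : List (Fin n), (∀ z ∈ L, ∑ u ∈ S, w z u ≤ 0) →
      L.foldl (fun S z => if 0 < ∑ u ∈ S, w z u then insert z S else S) S = S := by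
    intro L
    induction L with
    | nil => intro _; rfl
    | cons z L ih =>
      intro hL
      rw [List.foldl_cons, if_neg (not_lt.2 (hL z List.mem_cons_self))]
      exact ih fun y hy => hL y (List.mem_cons_of_mem _ hy)
  refine key _ fun z hz => h z ?_
  simpa using (List.mem_filter.1 hz).2

/-- A heaviest subgraph absorbs nothing. -/
lemma absorb_heaviest {n : ℕ} (R : Choices n) {w : Fin n → Fin n → ℤ}
    (hw : ∀ u v, w u v = w v u) (A : Finset (Fin n)) :
    absorb R w (R.heaviest (restrict w A) A) (A \ R.heaviest (restrict w A) A)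
      = R.heaviest (restrict w A) A := by
  refine absorb_eq_self R w _ _ fun z hz => ?_
  obtain ⟨hzA, hzS⟩ := Finset.mem_sdiff.1 hz
  have hsub := R.heaviest_subset (restrict w A) A
  -- Inserting `z` would add twice its weight to the set, so by maximality that weight is not
  -- positive.
  have hins : insert z (R.heaviest (restrict w A) A) ⊆ A := Finset.insert_subset hzA hsub
  have h := R.heaviest_max (restrict w A) A _ hins
  rw [inner_restrict w hins, inner_restrict w hsub, inner_insert hw hzS] at h
  linarith

/-! ### Deterministic analysis of the exploration -/

/-- No critical set is as heavy as the piece of the cluster it is compared with. -/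
def HeavyPieces {n : ℕ} (T : Clustering n) (R : Choices n) (l : ℕ) (w : Fin n → Fin n → ℤ) : Prop :=
  ∀ t ≤ n, ∀ K ∈ T.parts, ∀ S, Critical T l (R.first t) K S →
    inner w S < inner w (K ∩ R.first t)

/-- The majority vote over the chosen vertices of a large piece of a cluster is always right. -/
def GoodVotes {n : ℕ} (T : Clustering n) (R : Choices n) (l : ℕ) (w : Fin n → Fin n → ℤ) : Prop :=
  ∀ t : Fin n, ∀ K ∈ T.parts, l ≤ (K ∩ R.first t).card →
    (0 < ∑ u ∈ R.pick l (R.order t) (K ∩ R.first t), w (R.order t) u ↔ R.order t ∈ K)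

/-- The state after the vertices in `P` have been selected: the active clusters are the pieces
`K ∩ P` of some true clusters `K`, all of size at least `l`, the set `V'` consists of the pieces of
the others, and these have size at most `m`. -/
structure Invariant {n : ℕ} (T : Clustering n) (P : Finset (Fin n)) (l m : ℕ)
    (s : List (Finset (Fin n)) × Finset (Fin n)) : Prop where
  piece : ∀ C ∈ s.1, ∃ K ∈ T.parts, C = K ∩ P ∧ l ≤ C.card
  nodup : s.1.Nodup
  mem_rest : ∀ x, x ∈ s.2 ↔ x ∈ P ∧ ∀ C ∈ s.1, x ∉ C
  card_le : ∀ K ∈ T.parts, K ∩ P ∉ s.1 → (K ∩ P).card ≤ m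

lemma Invariant.subset_rest {n : ℕ} {T : Clustering n} {P : Finset (Fin n)} {l m : ℕ}
    {s : List (Finset (Fin n)) × Finset (Fin n)} (h : Invariant T P l m s)
    {K : Finset (Fin n)} (hK : K ∈ T.parts) (hKs : K ∩ P ∉ s.1) : K ∩ P ⊆ s.2 := by
  intro x hx
  obtain ⟨hxK, hxP⟩ := Finset.mem_inter.1 hx
  refine (h.mem_rest x).2 ⟨hxP, fun C hC hxC => ?_⟩
  obtain ⟨K', hK', rfl, -⟩ := h.piece C hC
  exact hKs (T.eq_of_mem_parts hK hK' hxK (Finset.mem_inter.1 hxC).1 ▸ hC)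

lemma Invariant.notMem_of_inter_rest {n : ℕ} {T : Clustering n} {P : Finset (Fin n)} {l m : ℕ}
    {s : List (Finset (Fin n)) × Finset (Fin n)} (h : Invariant T P l m s)
    {K : Finset (Fin n)} {x : Fin n} (hxK : x ∈ K) (hx : x ∈ s.2) : K ∩ P ∉ s.1 := fun hC =>
  ((h.mem_rest x).1 hx).2 _ hC (Finset.mem_inter.2 ⟨hxK, ((h.mem_rest x).1 hx).1⟩)

/-- Each extracted set must be a whole remaining piece, since otherwise it would be critical yet at
least as heavy as that piece. The bound improves from `2 * l` to `2 * l - 1`, which makes room for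
the next vertex. -/
lemma extract_invariant {n : ℕ} {T : Clustering n} {R : Choices n} {l t : ℕ}
    {w : Fin n → Fin n → ℤ} (hw : ∀ u v, w u v = w v u) (hl : 0 < l) (ht : t ≤ n)
    (hG : HeavyPieces T R l w) (active : List (Finset (Fin n))) (V : Finset (Fin n))
    (h : Invariant T (R.first t) l (2 * l) (active, V)) :
    Invariant T (R.first t) l (2 * l - 1) (extract R w l active V) := by
  induction hm : V.card using Nat.strong_induction_on generalizing active V with
  | _ m ih =>
  rw [extract]
  set S := R.heaviest (restrict w V) V with hSdef
  have hSV : S ⊆ V := R.heaviest_subset _ _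
  have hVP : V ⊆ R.first t := fun x hx => ((h.mem_rest x).1 hx).1
  have hmax : ∀ B ⊆ V, inner w B ≤ inner w S := fun B hB => by
    have := R.heaviest_max (restrict w V) V B hB
    rwa [inner_restrict w hB, inner_restrict w hSV] at this
  have hcrit : ∀ C ∈ T.parts, (S ∩ C).Nonempty → (C ∩ R.first t).card ≤ 2 * l := by
    rintro C hC ⟨x, hx⟩
    obtain ⟨hxS, hxC⟩ := Finset.mem_inter.1 hx
    exact h.card_le C hC (h.notMem_of_inter_rest hxC (hSV hxS))
  split_ifs with hc
  · obtain ⟨hcard, hne⟩ := hc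
    have habs : absorb R w S (V \ S) = S := absorb_heaviest R hw V
    have hSS : (V \ S) \ S = V \ S := by simp
    show Invariant T (R.first t) l (2 * l - 1)
      (extract R w l (active ++ [absorb R w S (V \ S)]) ((V \ S) \ absorb R w S (V \ S)))
    rw [habs, hSS]
    -- The cluster that `S` meets most. Its piece is not active, hence lies in `V` and competes with
    -- `S`.
    obtain ⟨K, hK, hKmax⟩ := Finset.exists_max_image T.parts (fun C => (S ∩ C).card)
      ⟨_, T.part_mem.2 (Finset.mem_univ hne.choose)⟩
    have hSK : (S ∩ K).Nonempty := by
      have hx : hne.choose ∈ S ∩ T.part hne.choose :=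
        Finset.mem_inter.2 ⟨hne.choose_spec, T.mem_part (Finset.mem_univ _)⟩
      have := hKmax _ (T.part_mem.2 (Finset.mem_univ hne.choose))
      exact Finset.card_pos.1 ((Finset.card_pos.2 ⟨_, hx⟩).trans_le this)
    obtain ⟨x, hx⟩ := hSK
    obtain ⟨hxS, hxK⟩ := Finset.mem_inter.1 hx
    have hKact : K ∩ R.first t ∉ active := h.notMem_of_inter_rest hxK (hSV hxS)
    have hSeq : S = K ∩ R.first t := by
      by_contra hne'
      exact absurd (hG t ht K hK S ⟨hSV.trans hVP, hcrit, hcrit K hK ⟨x, hx⟩,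
        Or.inl ⟨hcard, hne', hKmax⟩⟩) (not_lt.2 (hmax _ (h.subset_rest hK hKact)))
    refine ih _ ?_ _ _ ?_ rfl
    · rw [← hm]
      exact Finset.card_lt_card (Finset.sdiff_ssubset hSV hne)
    · refine ⟨?_, ?_, ?_, ?_⟩
      · intro C hC
        rcases List.mem_append.1 hC with hC | hC
        · exact h.piece C hC
        · rw [List.mem_singleton.1 hC]
          exact ⟨K, hK, hSeq, hcard⟩
      · refine List.nodup_append.2 ⟨h.nodup, List.nodup_singleton _, ?_⟩
        intro C hC D hD
        rw [List.mem_singleton.1 hD]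
        rintro rfl
        exact hKact (hSeq ▸ hC)
      · intro y
        have := h.mem_rest y
        simp only [Finset.mem_sdiff, List.mem_append, List.mem_singleton] at this ⊢
        rw [this]
        constructor
        · rintro ⟨⟨h1, h2⟩, h3⟩
          refine ⟨h1, ?_⟩
          rintro C (hC | rfl)
          · exact h2 C hC
          · exact h3
        · rintro ⟨h1, h2⟩
          exact ⟨⟨h1, fun C hC => h2 C (Or.inl hC)⟩, h2 S (Or.inr rfl)⟩
      · intro K' hK' hK'a
        exact h.card_le K' hK' fun h' => hK'a (List.mem_append.2 (Or.inl h'))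
  -- Extraction has stopped, so `S` has fewer than `l` vertices; a remaining piece with exactly `2 *
  -- l` vertices would then be heavier than `S`.
  · refine ⟨h.piece, h.nodup, h.mem_rest, fun K hK hKa => ?_⟩
    have hle := h.card_le K hK hKa
    by_contra hcon
    have heq : (K ∩ R.first t).card = 2 * l := by omega
    have hlt : S.card < l := by
      by_contra hge
      exact hc ⟨not_lt.1 hge, Finset.card_pos.1 (hl.trans_le (not_lt.1 hge))⟩
    exact absurd (hG t ht K hK S ⟨hSV.trans hVP, hcrit, hle, Or.inr ⟨heq, hlt⟩⟩)
      (not_lt.2 (hmax _ (h.subset_rest hK hKa)))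

lemma join_eq_none {n : ℕ} (R : Choices n) (w : Fin n → Fin n → ℤ) (l : ℕ) (v : Fin n)
    (active : List (Finset (Fin n))) (h : join R w l v active = none) :
    ∀ C ∈ active, ¬ 0 < ∑ u ∈ R.pick l v C, w v u := by
  induction active with
  | nil => simp
  | cons C Cs ih =>
    rw [join] at h
    split_ifs at h with hC
    intro D hD
    rcases List.mem_cons.1 hD with rfl | hD
    · exact hC
    · exact ih (Option.map_eq_none_iff.1 h) D hD

lemma join_eq_some {n : ℕ} (R : Choices n) (w : Fin n → Fin n → ℤ) (l : ℕ) (v : Fin n)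
    (active active' : List (Finset (Fin n))) (h : join R w l v active = some active') :
    ∃ pre C post, active = pre ++ C :: post ∧ active' = pre ++ insert v C :: post ∧
      0 < ∑ u ∈ R.pick l v C, w v u := by
  induction active generalizing active' with
  | nil => simp [join] at h
  | cons C Cs ih =>
    rw [join] at h
    split_ifs at h with hC
    · exact ⟨[], C, Cs, rfl, (Option.some.inj h).symm, hC⟩
    · obtain ⟨Cs', hCs', rfl⟩ := Option.map_eq_some_iff.1 h
      obtain ⟨pre, D, post, rfl, rfl, hD⟩ := ih Cs' hCs'
      exact ⟨C :: pre, D, post, rfl, rfl, hD⟩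

/-- A correct vote extends the piece of the right cluster. If no vote succeeds, the cluster of the
new vertex is not active, its piece grows by one to at most `2 * l`, and extraction restores the
bound. -/
lemma process_invariant {n : ℕ} {T : Clustering n} {R : Choices n} {l : ℕ}
    {w : Fin n → Fin n → ℤ} (hw : ∀ u v, w u v = w v u) (hl : 0 < l)
    (hG : HeavyPieces T R l w) (hV : GoodVotes T R l w) (t : Fin n)
    (s : List (Finset (Fin n)) × Finset (Fin n))
    (h : Invariant T (R.first t) l (2 * l - 1) s) :
    Invariant T (R.first (t + 1)) l (2 * l - 1) (process R w l s (R.order t)) := by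
  obtain ⟨active, V⟩ := s
  set v := R.order t with hv
  set P := R.first t with hP
  have hvP : v ∉ P := R.notMem_first t
  have hvote : ∀ K ∈ T.parts, K ∩ P ∈ active →
      (0 < ∑ u ∈ R.pick l v (K ∩ P), w v u ↔ v ∈ K) := by
    intro K hK hKa
    obtain ⟨_, _, _, hcard⟩ := h.piece _ hKa
    exact hV t K hK hcard
  have hin : ∀ K, v ∈ K → K ∩ insert v P = insert v (K ∩ P) := fun K hvK =>
    Finset.inter_insert_of_mem hvK
  have hout : ∀ K, v ∉ K → K ∩ insert v P = K ∩ P := fun K hvK =>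
    Finset.inter_insert_of_notMem hvK
  have hactP : ∀ C ∈ active, v ∉ C := by
    intro C hC hvC
    obtain ⟨K, -, rfl, -⟩ := h.piece C hC
    exact hvP (Finset.mem_inter.1 hvC).2
  rw [process]
  simp only
  cases hj : join R w l v active with
  | none =>
    have hnone := join_eq_none R w l v active hj
    have hnot : ∀ K ∈ T.parts, K ∩ P ∈ active → v ∉ K := fun K hK hKa hvK =>
      hnone _ hKa ((hvote K hK hKa).2 hvK)
    refine extract_invariant hw hl t.2 hG active _ ?_
    rw [R.first_succ, ← hv, ← hP]
    refine ⟨?_, h.nodup, ?_, ?_⟩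
    · intro C hC
      obtain ⟨K, hK, rfl, hcard⟩ := h.piece C hC
      exact ⟨K, hK, (hout K (hnot K hK hC)).symm, hcard⟩
    · intro x
      have := h.mem_rest x
      simp only [Finset.mem_insert] at this ⊢
      rw [this]
      constructor
      · rintro (rfl | h1)
        · exact ⟨Or.inl rfl, hactP⟩
        · exact ⟨Or.inr h1.1, h1.2⟩
      · rintro ⟨rfl | h1, h2⟩
        · exact Or.inl rfl
        · exact Or.inr ⟨h1, h2⟩
    · intro K hK hKa
      have hKP : K ∩ P ∉ active := by
        intro h'
        rw [hout K (hnot K hK h')] at hKa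
        exact hKa h'
      have h1 := h.card_le K hK hKP
      have h2 : (K ∩ insert v P).card ≤ (K ∩ P).card + 1 := by
        by_cases hvK : v ∈ K
        · rw [hin K hvK]; exact Finset.card_insert_le _ _
        · rw [hout K hvK]; omega
      omega
  | some active' =>
    obtain ⟨pre, C, post, rfl, rfl, hpos⟩ := join_eq_some R w l v active active' hj
    have hCmem : C ∈ pre ++ C :: post := by simp
    obtain ⟨K, hK, hCK, hcard⟩ := h.piece C hCmem
    have hvK : v ∈ K := (hvote K hK (hCK ▸ hCmem)).1 (hCK ▸ hpos)
    have huniq : ∀ K' ∈ T.parts, v ∈ K' → K' = K := fun K' hK' hvK' =>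
      T.eq_of_mem_parts hK' hK hvK' hvK
    obtain ⟨hnd1, hnd2, hnd3⟩ := List.nodup_append.1 h.nodup
    obtain ⟨hnd4, hnd5⟩ := List.nodup_cons.1 hnd2
    have hpreC : C ∉ pre := fun hC => hnd3 C hC C List.mem_cons_self rfl
    have hiC : insert v C ∉ pre ++ C :: post := fun h' =>
      hactP _ h' (Finset.mem_insert_self v C)
    have hmem : ∀ D, D ∈ pre ++ insert v C :: post ↔
        D = insert v C ∨ (D ∈ pre ++ C :: post ∧ D ≠ C) := by
      intro D
      simp only [List.mem_append, List.mem_cons]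
      constructor
      · rintro (hD | rfl | hD)
        · exact Or.inr ⟨Or.inl hD, fun h' => hpreC (h' ▸ hD)⟩
        · exact Or.inl rfl
        · exact Or.inr ⟨Or.inr (Or.inr hD), fun h' => hnd4 (h' ▸ hD)⟩
      · rintro (rfl | ⟨hD | rfl | hD, hne⟩)
        · exact Or.inr (Or.inl rfl)
        · exact Or.inl hD
        · exact absurd rfl hne
        · exact Or.inr (Or.inr hD)
    simp only
    rw [R.first_succ, ← hv, ← hP]
    refine ⟨?_, ?_, ?_, ?_⟩
    · intro D hD
      rcases (hmem D).1 hD with rfl | ⟨hD, hne⟩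
      · refine ⟨K, hK, by rw [hin K hvK, hCK], hcard.trans ?_⟩
        exact Finset.card_le_card (Finset.subset_insert _ _)
      · obtain ⟨K', hK', rfl, hcard'⟩ := h.piece D hD
        refine ⟨K', hK', (hout K' fun hvK' => hne ?_).symm, hcard'⟩
        rw [huniq K' hK' hvK', hCK]
    · refine List.nodup_append.2 ⟨hnd1, List.nodup_cons.2 ⟨?_, hnd5⟩, ?_⟩
      · exact fun h' => hiC (by simp [h'])
      · intro A hA B hB
        rcases List.mem_cons.1 hB with rfl | hB
        · rintro rfl
          exact hiC (by simp [hA])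
        · exact hnd3 A hA B (List.mem_cons_of_mem _ hB)
    · intro x
      have := h.mem_rest x
      simp only at this ⊢
      rw [this]
      constructor
      · rintro ⟨hxP, hx⟩
        refine ⟨Finset.mem_insert_of_mem hxP, fun D hD => ?_⟩
        rcases (hmem D).1 hD with rfl | ⟨hD, -⟩
        · rw [Finset.mem_insert]
          rintro (rfl | hxC)
          · exact hvP hxP
          · exact hx C hCmem hxC
        · exact hx D hD
      · rintro ⟨hxP, hx⟩
        have hxi := hx _ ((hmem _).2 (Or.inl rfl))
        rw [Finset.mem_insert, not_or] at hxi
        refine ⟨(Finset.mem_insert.1 hxP).resolve_left hxi.1, fun D hD => ?_⟩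
        by_cases hDC : D = C
        · exact hDC ▸ hxi.2
        · exact hx D ((hmem D).2 (Or.inr ⟨hD, hDC⟩))
    · intro K' hK' hK'a
      simp only at hK'a
      rw [hmem, not_or, not_and_not_right] at hK'a
      by_cases hvK' : v ∈ K'
      · rw [huniq K' hK' hvK'] at hK'a
        exact absurd (by rw [hin K hvK, hCK]) hK'a.1
      · rw [hout K' hvK'] at hK'a ⊢
        refine h.card_le K' hK' fun h' => ?_
        have h1 := hK'a.2 h'
        -- Distinct clusters can have equal pieces only if these are empty, which `0 < l` excludes
        -- here.
        have hCne : C.Nonempty := Finset.card_pos.1 (hl.trans_le hcard)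
        obtain ⟨x, hx⟩ := hCne
        have hx1 : x ∈ K' := (Finset.mem_inter.1 (h1 ▸ hx)).1
        have hx2 : x ∈ K := (Finset.mem_inter.1 (hCK ▸ hx)).1
        exact hvK' (T.eq_of_mem_parts hK hK' hx2 hx1 ▸ hvK)

lemma explore_invariant {n : ℕ} {T : Clustering n} {R : Choices n} {l : ℕ}
    {w : Fin n → Fin n → ℤ} (hw : ∀ u v, w u v = w v u) (hl : 0 < l) (hln : l ≤ n)
    (hG : HeavyPieces T R l w) (hV : GoodVotes T R l w) :
    Invariant T Finset.univ l (2 * l - 1) (explore R w l) := by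
  have key : ∀ k t, t + k = n → ∀ s, Invariant T (R.first t) l (2 * l - 1) s →
      Invariant T (R.first n) l (2 * l - 1) ((R.vertices.drop t).foldl (process R w l) s) := by
    intro k
    induction k with
    | zero =>
      intro t ht s hs
      rw [List.drop_of_length_le (by rw [R.length_vertices]; omega)]
      obtain rfl : t = n := by omega
      exact hs
    | succ k ih =>
      intro t ht s hs
      have htn : t < n := by omega
      rw [List.drop_eq_getElem_cons (by rw [R.length_vertices]; exact htn), List.foldl_cons,
        R.getElem_vertices ⟨t, htn⟩]
      exact ih (t + 1) (by omega) _ (process_invariant hw hl hG hV ⟨t, htn⟩ s hs)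
  rw [← R.first_all]
  -- At the start nothing is active and all pieces have at most `l` vertices, well within `2 * l`.
  refine key (n - l) l (by omega) _ (extract_invariant hw hl hln hG _ _ ?_)
  refine ⟨by simp, by simp, by simp [Choices.first], fun K _ _ => ?_⟩
  have h1 : (K ∩ R.first l).card ≤ (R.first l).card := Finset.card_le_card Finset.inter_subset_right
  have h2 := R.card_first_le l
  omega

/-! ### Likelihood and intra-cluster weight -/

lemma sum_ind_parts {n : ℕ} (T : Clustering n) (e : Pair n) :
    ∑ C ∈ T.parts, ind C e = (1 + sgn (truth T e)) / 2 := by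
  classical
  simp only [ind, sgn, truth, decide_eq_true_eq]
  split_ifs with h
  · obtain ⟨C, hC, hCe⟩ := h
    rw [Finset.sum_eq_single C]
    · rw [if_pos hCe]; norm_num
    · intro D hD hDC
      rw [if_neg]
      intro hDe
      obtain ⟨x, hx⟩ : ∃ x, x ∈ e.1 := ⟨_, e.1.out_fst_mem⟩
      exact hDC (T.eq_of_mem_parts hD hC (hDe x hx) (hCe x hx))
    · exact fun h => (h hC).elim
  · rw [Finset.sum_eq_zero]
    · norm_num
    · intro C hC
      rw [if_neg]
      exact fun hCe => h ⟨C, hC, hCe⟩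

lemma intraWeight_cast {n : ℕ} (a : Answers n) (T : Clustering n) :
    (intraWeight (weight a) T : ℝ)
      = ∑ e, sgn (a e) + ∑ e, sgn (a e) * sgn (truth T e) := by
  simp only [intraWeight, Int.cast_sum, inner_weight_cast]
  rw [← Finset.mul_sum, Finset.sum_comm]
  simp only [← Finset.sum_mul, sum_ind_parts]
  rw [Finset.mul_sum, ← Finset.sum_add_distrib]
  refine Finset.sum_congr rfl fun e _ => ?_
  ring

/-- Each pair contributes `1 - p` or `p` according to the sign of agreement `±1`, and both are the
exponential of one affine function of that sign. The slope is positive for `p < 1/2`, and by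
`intraWeight_cast` the sum of the signs is the intra-cluster weight up to a term independent of the
clustering. -/
lemma oracleLaw_real_singleton {n : ℕ} (p : unitInterval) (hp0 : 0 < (p : ℝ))
    (hp : (p : ℝ) < 1 / 2) (T : Clustering n) (a : Answers n) :
    (oracleLaw p T).real {a} = Real.exp (∑ _e : Pair n, (Real.log (1 - p) + Real.log p) / 2 +
      (Real.log (1 - p) - Real.log p) / 2 * ∑ e, sgn (a e) * sgn (truth T e)) := by
  rw [measureReal_def, oracleLaw, Measure.pi_singleton, ENNReal.toReal_prod, Finset.mul_sum,
    ← Finset.sum_add_distrib, Real.exp_sum]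
  refine Finset.prod_congr rfl fun e _ => ?_
  rw [← measureReal_def]
  have h1 : Real.exp ((Real.log (1 - p) + Real.log p) / 2 +
      (Real.log (1 - p) - Real.log p) / 2 * 1) = 1 - p := by
    rw [show (Real.log (1 - p) + Real.log p) / 2 +
      (Real.log (1 - p) - Real.log p) / 2 * 1 = Real.log (1 - p) by ring,
      Real.exp_log (by linarith)]
  have h2 : Real.exp ((Real.log (1 - p) + Real.log p) / 2 +
      (Real.log (1 - p) - Real.log p) / 2 * (-1)) = p := by
    rw [show (Real.log (1 - p) + Real.log p) / 2 +
      (Real.log (1 - p) - Real.log p) / 2 * (-1) = Real.log p by ring, Real.exp_log hp0]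
  by_cases he : a e = truth T e
  · have hs : sgn (a e) * sgn (truth T e) = 1 := by rw [he]; cases truth T e <;> simp [sgn]
    rw [hs, h1, ProbabilityTheory.bernoulliMeasure_real_apply_of_notMem_of_mem] <;> simp [he]
  · have he' : a e = !truth T e := by simpa [Bool.eq_not] using he
    have hs : sgn (a e) * sgn (truth T e) = -1 := by rw [he']; cases truth T e <;> simp [sgn]
    rw [hs, h2, ProbabilityTheory.bernoulliMeasure_real_apply_of_mem_of_notMem] <;> simp [he']

lemma oracleLaw_singleton_mono {n : ℕ} (p : unitInterval) (hp0 : 0 < (p : ℝ))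
    (hp : (p : ℝ) < 1 / 2) {T Q : Clustering n} {a : Answers n}
    (h : intraWeight (weight a) T ≤ intraWeight (weight a) Q) :
    oracleLaw p T {a} ≤ oracleLaw p Q {a} := by
  rw [← ENNReal.toReal_le_toReal (measure_ne_top _ _) (measure_ne_top _ _)]
  change (oracleLaw p T).real {a} ≤ (oracleLaw p Q).real {a}
  rw [oracleLaw_real_singleton p hp0 hp, oracleLaw_real_singleton p hp0 hp]
  have h' : (intraWeight (weight a) T : ℝ) ≤ intraWeight (weight a) Q := by exact_mod_cast h
  rw [intraWeight_cast, intraWeight_cast] at h'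
  have hlog : Real.log p ≤ Real.log (1 - p) := Real.log_le_log hp0 (by linarith)
  refine Real.exp_le_exp.2 (add_le_add le_rfl (mul_le_mul_of_nonneg_left ?_ ?_)) <;> linarith

lemma intraWeight_restrict {n : ℕ} (w : Fin n → Fin n → ℤ) {A : Finset (Fin n)}
    (Q : Finpartition A) : intraWeight (restrict w A) Q = intraWeight w Q :=
  Finset.sum_congr rfl fun _ hS => inner_restrict w (Q.subset hS)

/-- The output is a clustering at least as heavy as `T` if the exploration found true clusters and
left the others intact. -/
lemma exists_clustering_output {n : ℕ} (p : ℝ) {T : Clustering n} (R : Choices n) (a : Answers n)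
    {m : ℕ}
    (h : Invariant T Finset.univ (size p n) m (explore R (weight a) (size p n))) :
    ∃ Q : Clustering n, Q.parts = output p R a ∧
      intraWeight (weight a) T ≤ intraWeight (weight a) Q := by
  classical
  unfold output
  generalize explore R (weight a) (size p n) = s at h ⊢
  obtain ⟨active, V⟩ := s
  simp only
  set w := weight a
  set U := R.mlClustering (restrict w V) V
  have hact : ∀ C ∈ active, C ∈ T.parts := by
    intro C hC
    obtain ⟨K, hK, hCK, -⟩ := h.piece C hC
    rw [hCK, Finset.inter_univ]; exact hK
  have hV : ∀ x, x ∈ V ↔ ∀ C ∈ active, x ∉ C := fun x => by simpa using h.mem_rest x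
  have hdisj : Disjoint active.toFinset U.parts := by
    rw [Finset.disjoint_left]
    intro C hC hCU
    obtain ⟨x, hx⟩ := U.nonempty_of_mem_parts hCU
    exact (hV x).1 (U.subset hCU hx) C (List.mem_toFinset.1 hC) hx
  let Q : Clustering n := Finpartition.ofExistsUnique (active.toFinset ∪ U.parts)
    (fun _ _ => Finset.subset_univ _)
    (by
      intro x _
      by_cases hx : x ∈ V
      · obtain ⟨C, ⟨hC, hxC⟩, hCu⟩ := U.existsUnique_mem hx
        refine ⟨C, ⟨Finset.mem_union_right _ hC, hxC⟩, ?_⟩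
        rintro D ⟨hD, hxD⟩
        rcases Finset.mem_union.1 hD with hD | hD
        · exact absurd hxD ((hV x).1 hx D (List.mem_toFinset.1 hD))
        · exact hCu D ⟨hD, hxD⟩
      · have : ∃ C ∈ active, x ∈ C := by
          by_contra! hcon
          exact hx ((hV x).2 hcon)
        obtain ⟨C, hC, hxC⟩ := this
        refine ⟨C, ⟨Finset.mem_union_left _ (List.mem_toFinset.2 hC), hxC⟩, ?_⟩
        rintro D ⟨hD, hxD⟩
        rcases Finset.mem_union.1 hD with hD | hD
        · exact T.eq_of_mem_parts (hact D (List.mem_toFinset.1 hD)) (hact C hC) hxD hxC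
        · exact absurd (U.subset hD hxD) hx)
    (by
      intro h0
      rcases Finset.mem_union.1 h0 with h0 | h0
      · exact T.empty_notMem_parts (hact _ (List.mem_toFinset.1 h0))
      · exact U.empty_notMem_parts h0)
  refine ⟨Q, rfl, ?_⟩
  -- The true clusters that are not active partition `V`, so they compete with the optimal partition
  -- `U`.
  let W : Finpartition V := T.ofSubset (parts := T.parts \ active.toFinset) Finset.sdiff_subset
    (by
      ext x
      simp only [Finset.mem_sup, Finset.mem_sdiff, List.mem_toFinset, id, hV]
      constructor
      · rintro ⟨C, ⟨hC, hCa⟩, hxC⟩ D hD hxD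
        exact hCa (T.eq_of_mem_parts hC (hact D hD) hxC hxD ▸ hD)
      · intro hx
        exact ⟨T.part x, ⟨T.part_mem.2 (Finset.mem_univ x),
          fun h' => hx _ h' (T.mem_part (Finset.mem_univ x))⟩, T.mem_part (Finset.mem_univ x)⟩)
  have hWU : intraWeight w W ≤ intraWeight w U := by
    have := R.mlClustering_max (restrict w V) V W
    rwa [intraWeight_restrict, intraWeight_restrict] at this
  have hsub : active.toFinset ⊆ T.parts := fun C hC => hact C (List.mem_toFinset.1 hC)
  have hT : intraWeight w T = ∑ C ∈ active.toFinset, inner w C + intraWeight w W := by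
    rw [intraWeight, ← Finset.sum_sdiff hsub, add_comm]
    rfl
  have hQ : intraWeight w Q = ∑ C ∈ active.toFinset, inner w C + intraWeight w U :=
    Finset.sum_union hdisj
  rw [hT, hQ]
  exact add_le_add le_rfl hWU

/-! ### Probability of the good events -/

/-- A wrong majority vote of `v` among `l` vertices `A` of one cluster is unlikely. -/
lemma vote_prob_le {n : ℕ} (p : unitInterval) (T : Clustering n) (hp : (p : ℝ) ≤ 1 / 2)
    {L : ℝ} {l : ℕ} (hlL : 16 * L ≤ (1 - 2 * p) ^ 2 * l) {K A : Finset (Fin n)} {v : Fin n}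
    (hK : K ∈ T.parts) (hA : A ⊆ K) (hv : v ∉ A) (hcard : A.card = l) :
    (oracleLaw p T).real {a | ¬ (0 < ∑ u ∈ A, weight a v u ↔ v ∈ K)} ≤ Real.exp (-(6 * L)) := by
  classical
  let B : Finset (Pair n) := Finset.univ.filter fun e => ∃ u ∈ A, e.1 = s(v, u)
  have hsum : ∀ g : Pair n → ℝ, ∀ g' : Sym2 (Fin n) → ℝ, (∀ e : Pair n, g' e.1 = g e) →
      ∑ e ∈ B, g e = ∑ u ∈ A, g' s(v, u) := by
    intro g g' hg
    symm
    refine Finset.sum_bij (fun u hu => (⟨s(v, u), ?_⟩ : Pair n)) ?_ ?_ ?_ ?_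
    · rw [Sym2.mk_isDiag_iff]
      rintro rfl
      exact hv hu
    · intro u hu
      simp only [B, Finset.mem_filter, Finset.mem_univ, true_and]
      exact ⟨u, hu, rfl⟩
    · intro u hu u' hu' h
      exact Sym2.congr_right.1 (congrArg Subtype.val h)
    · intro e he
      obtain ⟨u, hu, heu⟩ := (Finset.mem_filter.1 he).2
      exact ⟨u, hu, Subtype.ext heu.symm⟩
    · intro u hu
      exact (hg ⟨s(v, u), _⟩)
  have hBcard : ∑ e ∈ B, (1 : ℝ) = l := by
    rw [hsum (fun _ => 1) (fun _ => 1) (fun _ => rfl)]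
    simp [hcard]
  have htruth : ∑ e ∈ B, sgn (truth T e) = l * (if v ∈ K then 1 else -1) := by
    rw [← hBcard, Finset.sum_mul]
    refine Finset.sum_congr rfl fun e he => ?_
    obtain ⟨u, hu, heu⟩ := (Finset.mem_filter.1 he).2
    obtain ⟨e, hd⟩ := e
    simp only at heu
    subst heu
    have hiff : truth T ⟨s(v, u), hd⟩ = true ↔ v ∈ K := by
      rw [truth_mk]
      refine ⟨?_, fun h => ⟨K, hK, h, hA hu⟩⟩
      rintro ⟨C, hC, hvC, huC⟩
      exact T.eq_of_mem_parts hC hK huC (hA hu) ▸ hvC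
    simp only [one_mul, sgn, hiff]
  have hw : ∀ a : Answers n, ((∑ u ∈ A, weight a v u : ℤ) : ℝ) = ∑ e ∈ B, sgn (a e) := by
    intro a
    rw [hsum (fun e => sgn (a e)) (extendSgn a) (extendSgn_pair a)]
    push_cast
    simp only [weight_cast]
  -- `ε` is the sign of a wrong vote; ties are included on both sides. The exponent `(1 - 2p)² * (-l
  -- / 2 + l / 8)` is at most `-6L`, as `16L ≤ (1 - 2p)² * l`.
  have key : ∀ ε : ℝ, ε ^ 2 = 1 → ε * (if v ∈ K then 1 else -1) = -1 →
      (oracleLaw p T).real {a | 0 ≤ ε * ∑ e ∈ B, sgn (a e)} ≤ Real.exp (-(6 * L)) := by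
    intro ε h1 h2
    have h := oracleLaw_sum_nonneg_le p T hp (fun e => if e ∈ B then ε else 0)
    simp only [ite_mul, zero_mul, Finset.sum_ite_mem, Finset.univ_inter, ← Finset.mul_sum,
      ite_pow, ne_eq, OfNat.ofNat_ne_zero, not_false_eq_true, zero_pow, htruth, h1, hBcard] at h
    refine h.trans (Real.exp_le_exp.2 ?_)
    have h3 : ε * (l * (if v ∈ K then (1 : ℝ) else -1)) = -l := by
      linear_combination (l : ℝ) * h2
    rw [h3]
    linarith
  by_cases hvK : v ∈ K
  · refine (measureReal_mono ?_ (measure_ne_top _ _)).trans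
      (key (-1) (by norm_num) (by simp [hvK]))
    intro a ha
    simp only [hvK, iff_true, not_lt, Set.mem_ofPred_eq] at ha ⊢
    rw [← hw]
    have : ((∑ u ∈ A, weight a v u : ℤ) : ℝ) ≤ 0 := by exact_mod_cast ha
    linarith
  · refine (measureReal_mono ?_ (measure_ne_top _ _)).trans
      (key 1 (by norm_num) (by simp [hvK]))
    intro a ha
    simp only [hvK, iff_false, not_not, Set.mem_ofPred_eq] at ha ⊢
    rw [← hw]
    have : (0 : ℝ) < ((∑ u ∈ A, weight a v u : ℤ) : ℝ) := by exact_mod_cast ha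
    linarith

lemma card_parts_le {n : ℕ} (T : Clustering n) : T.parts.card ≤ n := by
  simpa using T.card_parts_le_card

/-- The vertices that vote depend only on `t` and `K`, not on the answers, so at most `n * n` fixed
votes have to be controlled. -/
lemma not_goodVotes_prob_le {n : ℕ} (p : unitInterval) (T : Clustering n) (R : Choices n)
    (hp : (p : ℝ) ≤ 1 / 2) {L : ℝ} {l : ℕ} (hlL : 16 * L ≤ (1 - 2 * p) ^ 2 * l) :
    (oracleLaw p T).real {a | ¬ GoodVotes T R l (weight a)}
      ≤ n * (n * Real.exp (-(6 * L))) := by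
  classical
  let E : Fin n → Finset (Fin n) → Set (Answers n) := fun t K =>
    {a | l ≤ (K ∩ R.first t).card ∧ ¬ (0 < ∑ u ∈ R.pick l (R.order t) (K ∩ R.first t),
      weight a (R.order t) u ↔ R.order t ∈ K)}
  have hsub : {a | ¬ GoodVotes T R l (weight a)} ⊆ ⋃ t ∈ Finset.univ, ⋃ K ∈ T.parts, E t K := by
    intro a ha
    simp only [GoodVotes, Set.mem_ofPred_eq, not_forall] at ha
    obtain ⟨t, K, hK, hcard, hbad⟩ := ha
    simp only [Set.mem_iUnion]
    exact ⟨t, Finset.mem_univ _, K, hK, hcard, hbad⟩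
  have hE : ∀ t, ∀ K ∈ T.parts, (oracleLaw p T).real (E t K) ≤ Real.exp (-(6 * L)) := by
    intro t K hK
    by_cases hc : l ≤ (K ∩ R.first t).card
    · refine (measureReal_mono (fun a ha => ha.2) (measure_ne_top _ _)).trans
        (vote_prob_le p T hp hlL hK ?_ ?_ (R.pick_card l (R.order t) _ hc))
      · exact (R.pick_subset _ _ _).trans Finset.inter_subset_left
      · exact fun h => R.notMem_first t (Finset.mem_inter.1 (R.pick_subset _ _ _ h)).2
    · have : E t K = ∅ := Set.eq_empty_of_forall_notMem fun a ha => hc ha.1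
      rw [this, measureReal_empty]
      exact (Real.exp_pos _).le
  calc (oracleLaw p T).real {a | ¬ GoodVotes T R l (weight a)}
      ≤ (oracleLaw p T).real (⋃ t ∈ Finset.univ, ⋃ K ∈ T.parts, E t K) :=
        measureReal_mono hsub (measure_ne_top _ _)
    _ ≤ ∑ t, (oracleLaw p T).real (⋃ K ∈ T.parts, E t K) := measureReal_biUnion_finset_le _ _
    _ ≤ ∑ t : Fin n, ∑ K ∈ T.parts, (oracleLaw p T).real (E t K) :=
        Finset.sum_le_sum fun t _ => measureReal_biUnion_finset_le _ _
    _ ≤ ∑ t : Fin n, ∑ K ∈ T.parts, Real.exp (-(6 * L)) :=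
        Finset.sum_le_sum fun t _ => Finset.sum_le_sum fun K hK => hE t K hK
    _ = n * (T.parts.card * Real.exp (-(6 * L))) := by simp
    _ ≤ n * (n * Real.exp (-(6 * L))) := by
        gcongr
        exact card_parts_le T

/-- The union runs over the `n + 1` prefixes, not over the possible sets `V'`; this is why
criticality is stated relative to the prefix. -/
lemma not_heavyPieces_prob_le {n : ℕ} (p : unitInterval) (T : Clustering n) (R : Choices n)
    (hp : (p : ℝ) ≤ 1 / 2) {L M : ℝ} {l : ℕ} (hl : 1000 ≤ l)
    (hlL : 16 * L ≤ (1 - 2 * p) ^ 2 * l) (hn : n * Real.exp (-L) ≤ 1)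
    (hM : (1 + Real.exp (-(L / 24))) ^ (2 * l) ≤ M) :
    (oracleLaw p T).real {a | ¬ HeavyPieces T R l (weight a)}
      ≤ (n + 1) * (n * (Real.exp (-(3 * L)) * (M * Real.exp M))) := by
  classical
  have hM0 : 0 ≤ M := le_trans (by positivity) hM
  let E : Finset (Fin n) → Finset (Fin n) → Finset (Fin n) → Set (Answers n) := fun P K S =>
    {a | inner (weight a) (K ∩ P) ≤ inner (weight a) S}
  let F : Finset (Fin n) → Finset (Fin n) → Finset (Finset (Fin n)) := fun P K =>
    Finset.univ.filter (Critical T l P K)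
  have hsub : {a | ¬ HeavyPieces T R l (weight a)} ⊆
      ⋃ t ∈ Finset.range (n + 1), ⋃ K ∈ T.parts, ⋃ S ∈ F (R.first t) K, E (R.first t) K S := by
    intro a ha
    simp only [HeavyPieces, Set.mem_ofPred_eq, not_forall, not_lt] at ha
    obtain ⟨t, ht, K, hK, S, hS, hbad⟩ := ha
    simp only [Set.mem_iUnion]
    exact ⟨t, Finset.mem_range.2 (by omega), K, hK, S,
      Finset.mem_filter.2 ⟨Finset.mem_univ _, hS⟩, hbad⟩
  calc (oracleLaw p T).real {a | ¬ HeavyPieces T R l (weight a)}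
      ≤ (oracleLaw p T).real (⋃ t ∈ Finset.range (n + 1), ⋃ K ∈ T.parts,
          ⋃ S ∈ F (R.first t) K, E (R.first t) K S) := measureReal_mono hsub (measure_ne_top _ _)
    _ ≤ ∑ t ∈ Finset.range (n + 1), ∑ K ∈ T.parts, ∑ S ∈ F (R.first t) K,
          (oracleLaw p T).real (E (R.first t) K S) := by
        refine (measureReal_biUnion_finset_le _ _).trans (Finset.sum_le_sum fun t _ => ?_)
        refine (measureReal_biUnion_finset_le _ _).trans (Finset.sum_le_sum fun K _ => ?_)
        exact measureReal_biUnion_finset_le _ _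
    _ ≤ ∑ t ∈ Finset.range (n + 1), ∑ K ∈ T.parts, Real.exp (-(3 * L)) * (M * Real.exp M) :=
        Finset.sum_le_sum fun t _ => Finset.sum_le_sum fun K hK =>
          sum_critical_prob_le p T hp hl hlL hn hM hK
    _ = (n + 1) * (T.parts.card * (Real.exp (-(3 * L)) * (M * Real.exp M))) := by simp
    _ ≤ (n + 1) * (n * (Real.exp (-(3 * L)) * (M * Real.exp M))) := by
        gcongr
        exact card_parts_le T

/-! ### Asymptotics in `n` -/

lemma size_mul_ge (p : unitInterval) (hp : (p : ℝ) < 1 / 2) (n : ℕ) :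
    16 * Real.log n ≤ (1 - 2 * (p : ℝ)) ^ 2 * size p n := by
  have h0 : 0 < (1 - 2 * (p : ℝ)) ^ 2 := by
    have : 0 < 1 - 2 * (p : ℝ) := by linarith
    positivity
  have h1 : 16 / (1 - 2 * (p : ℝ)) ^ 2 * Real.log n ≤ size p n := Nat.le_ceil _
  calc 16 * Real.log n = (1 - 2 * (p : ℝ)) ^ 2 * (16 / (1 - 2 * (p : ℝ)) ^ 2 * Real.log n) := by
        rw [← mul_assoc, mul_div_cancel₀ _ h0.ne']
    _ ≤ _ := mul_le_mul_of_nonneg_left h1 h0.le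

/-- The conditions on `n` under which the union bounds are small. -/
def LargeEnough (p : ℝ) (n : ℕ) : Prop :=
  2 ≤ n ∧ 1000 ≤ size p n ∧ size p n ≤ n ∧
    (1 + Real.exp (-(Real.log n / 24))) ^ (2 * size p n) ≤ Real.exp 1

lemma eventually_largeEnough (p : unitInterval) (hp : (p : ℝ) < 1 / 2) :
    ∀ᶠ n : ℕ in atTop, LargeEnough p n := by
  set c : ℝ := 16 / (1 - 2 * (p : ℝ)) ^ 2 with hc
  have hc0 : 0 < c := by
    have : 0 < 1 - 2 * (p : ℝ) := by linarith
    positivity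
  have hsize : ∀ n : ℕ, 2 ≤ n → (size p n : ℝ) ≤ c * Real.log n + 1 := fun n hn =>
    (Nat.ceil_lt_add_one (mul_nonneg hc0.le (Real.log_natCast_nonneg n))).le
  have hlog : Tendsto (fun n : ℕ => c * Real.log n) atTop atTop :=
    (Real.tendsto_log_atTop.comp tendsto_natCast_atTop_atTop).const_mul_atTop hc0
  have hnat : Tendsto (fun n : ℕ => (n : ℝ)) atTop atTop := tendsto_natCast_atTop_atTop
  have ho : ∀ r : ℝ, 0 < r → ∀ᶠ n : ℕ in atTop, Real.log n ≤ (1 / (4 * c)) * (n : ℝ) ^ r := by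
    intro r hr
    have := ((isLittleO_log_rpow_atTop hr).bound (show 0 < 1 / (4 * c) by positivity))
    filter_upwards [hnat.eventually this] with n hn
    rw [Real.norm_eq_abs, Real.norm_eq_abs, abs_of_nonneg (Real.log_natCast_nonneg n),
      abs_of_nonneg (by positivity)] at hn
    exact hn
  have hpow : Tendsto (fun n : ℕ => (n : ℝ) ^ (1 / 24 : ℝ)) atTop atTop :=
    (tendsto_rpow_atTop (by norm_num)).comp hnat
  filter_upwards [eventually_ge_atTop 2, hlog.eventually_ge_atTop 1000, ho 1 one_pos,
    ho (1 / 24) (by norm_num), hpow.eventually_ge_atTop 4] with n h2 h1000 ho1 ho24 h4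
  have hn0 : (0 : ℝ) < n := by exact_mod_cast (by omega : 0 < n)
  have hs := hsize n h2
  refine ⟨h2, ?_, ?_, ?_⟩
  · have : c * Real.log n ≤ size p n := Nat.le_ceil _
    exact_mod_cast h1000.trans this
  · rw [Real.rpow_one] at ho1
    have h5 : c * Real.log n ≤ n / 4 := by
      calc c * Real.log n ≤ c * (1 / (4 * c) * n) := mul_le_mul_of_nonneg_left ho1 hc0.le
        _ = n / 4 := by field_simp
    have : (size p n : ℝ) ≤ n := by linarith
    exact_mod_cast this
  -- The power is at most `exp (2l / y)`, and `2l ≤ 2 * (c * log n + 1) ≤ y / 2 + 2 ≤ y` once `y ≥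
  -- 4`.
  · set y := (n : ℝ) ^ (1 / 24 : ℝ) with hy
    have hy0 : 0 < y := by positivity
    have hexp : Real.exp (-(Real.log n / 24)) = 1 / y := by
      rw [hy, Real.rpow_def_of_pos hn0, Real.exp_neg, one_div]
      congr 2; ring
    have h5 : c * Real.log n ≤ y / 4 := by
      calc c * Real.log n ≤ c * (1 / (4 * c) * y) := mul_le_mul_of_nonneg_left ho24 hc0.le
        _ = y / 4 := by field_simp
    rw [hexp]
    calc (1 + 1 / y) ^ (2 * size p n) ≤ (Real.exp (1 / y)) ^ (2 * size p n) := by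
          refine pow_le_pow_left₀ (by positivity) ?_ _
          rw [add_comm]; exact Real.add_one_le_exp _
      _ = Real.exp ((2 * size p n : ℕ) * (1 / y)) := by rw [Real.exp_nat_mul]
      _ ≤ Real.exp 1 := by
          refine Real.exp_le_exp.2 ?_
          rw [mul_one_div, div_le_one hy0]
          push_cast
          linarith

/-- The bound on the failure probability for large `n`. -/
noncomputable def failureBound : ℝ := 2 * (Real.exp 1 * Real.exp (Real.exp 1)) + 1

lemma good_prob_ge {n : ℕ} (p : unitInterval) (hp : (p : ℝ) < 1 / 2) (hn : LargeEnough p n)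
    (T : Clustering n) (R : Choices n) :
    1 - failureBound / n ≤ (oracleLaw p T).real {a | HeavyPieces T R (size p n) (weight a) ∧
      GoodVotes T R (size p n) (weight a)} := by
  obtain ⟨h2, hl, -, hM⟩ := hn
  have hn0 : (0 : ℝ) < n := by exact_mod_cast (by omega : 0 < n)
  have hn1 : (1 : ℝ) ≤ n := by exact_mod_cast (by omega : 1 ≤ n)
  have hexp : ∀ k : ℕ, Real.exp (-(k * Real.log n)) = ((n : ℝ) ^ k)⁻¹ := fun k => by
    rw [Real.exp_neg, Real.exp_nat_mul, Real.exp_log hn0]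
  have e1 : (n : ℝ) * Real.exp (-Real.log n) ≤ 1 := by
    have := hexp 1
    rw [Nat.cast_one, one_mul, pow_one] at this
    rw [this, mul_inv_cancel₀ hn0.ne']
  have b1 := not_heavyPieces_prob_le p T R hp.le hl (size_mul_ge p hp n) e1 hM
  have b2 := not_goodVotes_prob_le p T R hp.le (size_mul_ge p hp n)
  rw [show 3 * Real.log n = ((3 : ℕ) : ℝ) * Real.log n by norm_num, hexp] at b1
  rw [show 6 * Real.log n = ((6 : ℕ) : ℝ) * Real.log n by norm_num, hexp] at b2
  set M := Real.exp 1 * Real.exp (Real.exp 1) with hMdef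
  have hM0 : 0 ≤ M := by positivity
  -- The spare `n⁻³` beats the `(n + 1) * n` choices of prefix and cluster and leaves order `1 / n`.
  have c1 : ((n : ℝ) + 1) * (n * (((n : ℝ) ^ 3)⁻¹ * M)) ≤ 2 * M / n := by
    calc ((n : ℝ) + 1) * (n * (((n : ℝ) ^ 3)⁻¹ * M))
        ≤ (2 * n) * (n * (((n : ℝ) ^ 3)⁻¹ * M)) :=
          mul_le_mul_of_nonneg_right (by linarith) (by positivity)
      _ = 2 * M / n := by field_simp
  have c2 : (n : ℝ) * (n * ((n : ℝ) ^ 6)⁻¹) ≤ 1 / n := by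
    have : (n : ℝ) * (n * ((n : ℝ) ^ 6)⁻¹) = 1 / n * ((n : ℝ) ^ 3)⁻¹ := by field_simp
    rw [this]
    exact mul_le_of_le_one_right (by positivity) (inv_le_one_of_one_le₀ (one_le_pow₀ hn1))
  set A : Set (Answers n) := {a | HeavyPieces T R (size p n) (weight a) ∧
      GoodVotes T R (size p n) (weight a)}
  have hcompl : (oracleLaw p T).real Aᶜ ≤ failureBound / n := by
    have hsub : Aᶜ ⊆ {a | ¬ HeavyPieces T R (size p n) (weight a)} ∪
        {a | ¬ GoodVotes T R (size p n) (weight a)} := by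
      intro a ha
      by_cases h : HeavyPieces T R (size p n) (weight a)
      · exact Or.inr fun h' => ha ⟨h, h'⟩
      · exact Or.inl h
    refine (measureReal_mono hsub (measure_ne_top _ _)).trans
      ((measureReal_union_le _ _).trans ?_)
    rw [failureBound, ← hMdef, add_div]
    exact add_le_add (b1.trans c1) (b2.trans c2)
  rw [probReal_compl_eq_one_sub (Set.toFinite A).measurableSet] at hcompl
  linarith

end FaultyOracle

theorem mainTheorem3 (p : unitInterval) (hp0 : 0 < (p : ℝ)) (hp : (p : ℝ) < 1 / 2) :
    ∃ ε : ℕ → ℝ, Tendsto ε atTop (𝓝 0) ∧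
      ∀ (n : ℕ) (T : FaultyOracle.Clustering n) (R : FaultyOracle.Choices n),
        1 - ε n ≤ (FaultyOracle.oracleLaw p T).real
          {a | FaultyOracle.IsUniqueML p a T → FaultyOracle.output p R a = T.parts} ∧
        1 - ε n ≤ (FaultyOracle.oracleLaw p T).real
          {a | FaultyOracle.IsML p a T → ∃ Q : FaultyOracle.Clustering n,
            FaultyOracle.IsML p a Q ∧ FaultyOracle.output p R a = Q.parts} ∧
        1 - ε n ≤ (FaultyOracle.oracleLaw p T).real
          {a | ∀ C ∈ T.parts, 96 / (1 - 2 * (p : ℝ)) ^ 2 * Real.log n ≤ (C.card : ℝ) →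
            C ∈ FaultyOracle.output p R a} := by
  classical
  -- For the finitely many other `n` the value `1` makes the claims trivial.
  refine ⟨fun n => if FaultyOracle.LargeEnough p n then FaultyOracle.failureBound / n else 1,
    ?_, ?_⟩
  · refine (tendsto_const_div_atTop_nhds_zero_nat FaultyOracle.failureBound).congr' ?_
    filter_upwards [FaultyOracle.eventually_largeEnough p hp] with n hn
    rw [if_pos hn]
  intro n T R
  by_cases hn : FaultyOracle.LargeEnough p n
  swap
  · simp only [if_neg hn, sub_self]
    exact ⟨measureReal_nonneg, measureReal_nonneg, measureReal_nonneg⟩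
  simp only [if_pos hn]
  have hgood := FaultyOracle.good_prob_ge p hp hn T R
  obtain ⟨h2, hl, hln, -⟩ := hn
  have hinv : ∀ a : FaultyOracle.Answers n,
      FaultyOracle.HeavyPieces T R (FaultyOracle.size p n) (FaultyOracle.weight a) ∧
        FaultyOracle.GoodVotes T R (FaultyOracle.size p n) (FaultyOracle.weight a) →
      FaultyOracle.Invariant T Finset.univ (FaultyOracle.size p n) (2 * FaultyOracle.size p n - 1)
        (FaultyOracle.explore R (FaultyOracle.weight a) (FaultyOracle.size p n)) := fun a ha =>
    FaultyOracle.explore_invariant (FaultyOracle.weight_symm a) (by omega) hln ha.1 ha.2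
  have hML : ∀ a : FaultyOracle.Answers n, ∀ Q : FaultyOracle.Clustering n,
      FaultyOracle.intraWeight (FaultyOracle.weight a) T ≤
        FaultyOracle.intraWeight (FaultyOracle.weight a) Q →
      FaultyOracle.IsML p a T → FaultyOracle.IsML p a Q := fun a Q hle hT Q' =>
    (hT Q').trans (FaultyOracle.oracleLaw_singleton_mono p hp0 hp hle)
  refine ⟨hgood.trans (measureReal_mono ?_ (measure_ne_top _ _)),
    hgood.trans (measureReal_mono ?_ (measure_ne_top _ _)),
    hgood.trans (measureReal_mono ?_ (measure_ne_top _ _))⟩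
  · intro a ha hT
    obtain ⟨Q, hQ, hle⟩ := FaultyOracle.exists_clustering_output p R a (hinv a ha)
    rw [← hQ, hT.2 Q (hML a Q hle hT.1)]
  · intro a ha hT
    obtain ⟨Q, hQ, hle⟩ := FaultyOracle.exists_clustering_output p R a (hinv a ha)
    exact ⟨Q, hML a Q hle hT, hQ.symm⟩
  · intro a ha C hC hcard
    have h := hinv a ha
    have hmem : C ∈ (FaultyOracle.explore R (FaultyOracle.weight a) (FaultyOracle.size p n)).1 := by
      by_contra hnot
      have h1 := h.card_le C hC (by rwa [Finset.inter_univ])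
      rw [Finset.inter_univ] at h1
      -- A remaining cluster has at most `2 * l - 1 < 2c * log n + 1` vertices, which is less than
      -- `6c * log n` since `1000 ≤ l`.
      have h3 : (C.card : ℝ) + 1 ≤ 2 * FaultyOracle.size p n := by
        exact_mod_cast (by omega : C.card + 1 ≤ 2 * FaultyOracle.size p n)
      have h4 : (FaultyOracle.size p n : ℝ) < 16 / (1 - 2 * (p : ℝ)) ^ 2 * Real.log n + 1 :=
        Nat.ceil_lt_add_one (mul_nonneg (by positivity) (Real.log_natCast_nonneg n))
      have h5 : 96 / (1 - 2 * (p : ℝ)) ^ 2 * Real.log n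
          = 6 * (16 / (1 - 2 * (p : ℝ)) ^ 2 * Real.log n) := by ring
      have h6 : (1000 : ℝ) ≤ FaultyOracle.size p n := by exact_mod_cast hl
      linarith
    exact Finset.mem_union_left _ (List.mem_toFinset.2 hmem)
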